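/- Theorem 3 (Gaussian upper bound). Fix $L$ subchannels and consider the parallel Gaussian relay-eavesdropper channel: for $l=1,\dots,L$ and time $i$, with source input $X_{1l,i}$ and relay input $X_{2l,i}$, the relay, the destination and the eavesdropper receive $$Y_{1l,i}=X_{1l,i}+Z_{1l,i},\qquad Y_{l,i}=X_{1l,i}+\sqrt{\rho_{1l}}\,X_{2l,i}+Z_{l,i},\qquad Y_{2l,i}=X_{1l,i}+\sqrt{\rho_{2l}}\,X_{2l,i}+Z_{2l,i},$$ where $\rho_{1l},\rho_{2l}\ge 0$ and the noises are centered Gaussian with variances $\sigma_{1l}^2,\sigma_l^2,\sigma_{2l}^2>0$, independent of one another and over all $l$ and $i$. A $(2^{nR},n)$ code consists of a uniform message $W\in\{1,\dots,\lceil 2^{nR}\rceil\}$, a stochastic source encoder $W\mapsto X_{1[1,L]}^n$, a causal relay encoder that forms $X_{2[1,L],i}$ from $Y_{1[1,L]}^{i-1}$ (and possibly from private randomness independent of everything else), and a decoder $g(Y_{[1,L]}^n)$ with average error probability $P_e^n=\Pr\{g(Y_{[1,L]}^n)\ne W\}$. It satisfies the power constraints $$\frac1n\sum_{l=1}^L\sum_{i=1}^n\mathbb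 E[X_{1l,i}^2]\le P_1,\qquad \frac1n\sum_{l=1}^L\sum_{i=1}^n\mathbb E[X_{2l,i}^2]\le P_2,\qquad P_1,P_2\ge 0.$$ A pair $(R,R_e)$ is achievable if for every $\epsilon>0$ there are such codes for all sufficiently large $n$ with $H(W)/n\ge R-\epsilon$, $H(W\mid Y_{2[1,L]}^n)/n\ge R_e-\epsilon$ and $P_e^n\le\epsilon$; a secrecy rate $R$ is achievable if $(R,R)$ is. Entropies and mutual informations are in bits. Then the maximum $$B=\max\ \sum_{l=1}^L\big[I(X_{1l}X_{2l};Y_l)-I(X_{1l}X_{2l};Y_{2l})\big]$$ over jointly Gaussian inputs $(X_{1l},X_{2l})\sim\mathcal N\!\left(0,\begin{pmatrix}P_{1l}&\psi_l\sqrt{P_{1l}P_{2l}}\\ \psi_l\sqrt{P_{1l}P_{2l}}&P_{2l}\end{pmatrix}\right)$, $l=1,\dots,L$, with $P_{1l},P_{2l}\ge0$, $-1\le\psi_l\le1$, $\sum_lP_{1l}\le P_1$ and $\sum_lP_{2l}\le P_2$, is attained, and every achievable pair $(R,R_e)$ satisfies $R_e\le B$. In particular every achievable secrecy rate is at most $B$.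 -/

import Mathlib

open MeasureTheory ProbabilityTheory
open scoped NNReal ENNReal

noncomputable section

namespace RelayEavesdropper

/-! ### Information measures (in bits) -/

/-- Mutual information `I(X;Y)` in bits: the Kullback-Leibler divergence of the joint law of `X` and
`Y` from the product of their laws. -/
def mutualInfo {Ω α β : Type*} [MeasurableSpace Ω] [MeasurableSpace α] [MeasurableSpace β]
    (X : Ω → α) (Y : Ω → β) (μ : Measure Ω) : ℝ :=
  (InformationTheory.klDiv (μ.map fun ω => (X ω, Y ω)) ((μ.map X).prod (μ.map Y))).toReal
    / Real.log 2

/-- Shannon entropy, in bits, of a law on a finite set. -/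
def entropy {α : Type*} [Fintype α] [MeasurableSpace α] (p : Measure α) : ℝ :=
  (∑ a, Real.negMulLog (p.real {a})) / Real.log 2

/-- Conditional entropy `H(W|Y)` in bits of a finitely valued `W` given an arbitrary `Y`: the mean
over `Y` of the entropy of the conditional law of `W` given `Y`. -/
def condEntropy {Ω β : Type*} [MeasurableSpace Ω] [MeasurableSpace β] {M : ℕ} [NeZero M]
    (W : Ω → Fin M) (Y : Ω → β) (μ : Measure Ω) [IsFiniteMeasure μ] : ℝ :=
  ∫ y, entropy (condDistrib W Y μ y) ∂(μ.map Y)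

/-! ### The channel -/

/-- Parameters of a parallel Gaussian relay-eavesdropper channel with `L` subchannels. Subchannel
`l` maps the source input `x₁` and the relay input `x₂` to the outputs
`x₁ + Z₁` (relay), `x₁ + √ρ₁ x₂ + Z` (destination), `x₁ + √ρ₂ x₂ + Z₂` (eavesdropper). -/
structure GaussianChannel (L : ℕ) where
  /-- relay-to-destination over source-to-destination SNR ratio -/
  ρ₁ : Fin L → ℝ≥0
  /-- relay-to-eavesdropper over source-to-eavesdropper SNR ratio -/
  ρ₂ : Fin L → ℝ≥0
  /-- noise variance at the relay -/
  varRelay : Fin L → ℝ≥0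
  /-- noise variance at the destination -/
  varDest : Fin L → ℝ≥0
  /-- noise variance at the eavesdropper -/
  varEve : Fin L → ℝ≥0
  varRelay_pos : ∀ l, 0 < varRelay l
  varDest_pos : ∀ l, 0 < varDest l
  varEve_pos : ∀ l, 0 < varEve l

/-- Signals over `n` channel uses and `L` subchannels. -/
abbrev Signal (n L : ℕ) : Type := Fin n → Fin L → ℝ

/-- Law of a noise process: independent centered Gaussians, with variance `v l` on subchannel `l`
at every time. -/
def noiseLaw (n : ℕ) {L : ℕ} (v : Fin L → ℝ≥0) : Measure (Signal n L) :=
  Measure.pi fun _ => Measure.pi fun l => gaussianReal 0 (v l)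

instance (n : ℕ) {L : ℕ} (v : Fin L → ℝ≥0) : IsProbabilityMeasure (noiseLaw n v) := by
  unfold noiseLaw; infer_instance

/-! ### Codes -/

/-- A code of length `n` with `M` messages: a stochastic source encoder, a causal relay encoder and
a decoder at the destination. The relay input at time `i` is a function of the signals that the
relay received before time `i` and of private randomness of the relay (a deterministic relay is the
case where this randomness is not used). -/
structure Code (L n M : ℕ) where
  source : Kernel (Fin M) (Signal n L)
  [isMarkov_source : IsMarkovKernel source]
  seedLaw : Measure ℝ
  [isProb_seedLaw : IsProbabilityMeasure seedLaw]
  relay : (i : Fin n) → ℝ → (Fin i → Fin L → ℝ) → (Fin L → ℝ)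
  measurable_relay : ∀ i : Fin n, Measurable fun p : ℝ × (Fin i → Fin L → ℝ) => relay i p.1 p.2
  decoder : Signal n L → Fin M
  measurable_decoder : Measurable decoder

attribute [instance] Code.isMarkov_source Code.isProb_seedLaw

/-- Sample space of a transmission: message and source input, private randomness of the relay, and
the noises at the relay, at the destination and at the eavesdropper. -/
abbrev Sample (L n M : ℕ) : Type :=
  (Fin M × Signal n L) × ℝ × Signal n L × Signal n L × Signal n L

namespace Code

variable {L n M : ℕ} (c : Code L n M) (ch : GaussianChannel L)

/-- Law of a transmission: the message is uniform, the source encodes it, and the randomness of the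
relay and the three noise processes are independent of this and of one another. -/
def law : Measure (Sample L n M) :=
  (uniformOn (Set.univ : Set (Fin M)) ⊗ₘ c.source).prod
    (c.seedLaw.prod ((noiseLaw n ch.varRelay).prod
      ((noiseLaw n ch.varDest).prod (noiseLaw n ch.varEve))))

instance [NeZero M] : IsProbabilityMeasure (c.law ch) := by
  unfold law; infer_instance

/-- The message `W`. -/
def message (ω : Sample L n M) : Fin M := ω.1.1

/-- The source input. -/
def sourceInput (ω : Sample L n M) : Signal n L := ω.1.2

/-- The signal received by the relay. -/
def relayOutput (ω : Sample L n M) : Signal n L :=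
  fun i l => sourceInput ω i l + ω.2.2.1 i l

/-- The relay input: at time `i` it depends only on what the relay received before time `i`. -/
def relayInput (ω : Sample L n M) : Signal n L :=
  fun i => c.relay i ω.2.1 fun j => relayOutput ω (Fin.castLE i.2.le j)

/-- The signal received by the destination. -/
def destOutput (ω : Sample L n M) : Signal n L :=
  fun i l => sourceInput ω i l + √(ch.ρ₁ l : ℝ) * c.relayInput ω i l + ω.2.2.2.1 i l

/-- The signal received by the eavesdropper. -/
def eveOutput (ω : Sample L n M) : Signal n L :=
  fun i l => sourceInput ω i l + √(ch.ρ₂ l : ℝ) * c.relayInput ω i l + ω.2.2.2.2 i l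

/-- Average error probability; the message being uniform, this is the mean over the messages of
the conditional probability of a decoding error. -/
def errorProb : ℝ :=
  (c.law ch).real {ω | c.decoder (c.destOutput ch ω) ≠ message ω}

/-- The average power constraints
`(1/n) ∑ₗ ∑ᵢ E[X₁ₗᵢ²] ≤ P₁` and `(1/n) ∑ₗ ∑ᵢ E[X₂ₗᵢ²] ≤ P₂`. -/
def SatisfiesPower (P₁ P₂ : ℝ) : Prop :=
  (∑ l, ∑ i, ∫⁻ ω, ENNReal.ofReal (sourceInput ω i l ^ 2) ∂(c.law ch)
      ≤ ENNReal.ofReal (n * P₁)) ∧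
  (∑ l, ∑ i, ∫⁻ ω, ENNReal.ofReal (c.relayInput ω i l ^ 2) ∂(c.law ch)
      ≤ ENNReal.ofReal (n * P₂))

end Code

/-! ### Achievability -/

/-- Number of messages of a `(2^{nR}, n)` code. -/
def numMessages (n : ℕ) (R : ℝ) : ℕ := ⌈(2 : ℝ) ^ ((n : ℝ) * R)⌉₊

instance (n : ℕ) (R : ℝ) : NeZero (numMessages n R) :=
  ⟨(Nat.ceil_pos.2 (Real.rpow_pos_of_pos two_pos _)).ne'⟩

/-- The rate-equivocation pair `(R, Re)` is achievable under the power constraints. -/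
def IsAchievable {L : ℕ} (ch : GaussianChannel L) (P₁ P₂ R Re : ℝ) : Prop :=
  ∀ ε > 0, ∃ N : ℕ, ∀ n ≥ N, ∃ c : Code L n (numMessages n R),
    c.SatisfiesPower ch P₁ P₂ ∧
    R - ε ≤ entropy ((c.law ch).map Code.message) / n ∧
    Re - ε ≤ condEntropy Code.message (c.eveOutput ch) (c.law ch) / n ∧
    c.errorProb ch ≤ ε

/-- The secrecy rate `R` is achievable: reliable transmission at rate `R` with perfect secrecy. -/
def IsAchievableSecrecyRate {L : ℕ} (ch : GaussianChannel L) (P₁ P₂ R : ℝ) : Prop :=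
  IsAchievable ch P₁ P₂ R R

/-! ### The Gaussian bound -/

/-- The covariance matrix of the two inputs of a subchannel with powers `p₁`, `p₂` and
correlation `ψ`. -/
def inputCov (p₁ p₂ ψ : ℝ) : Matrix (Fin 2) (Fin 2) ℝ :=
  !![p₁, ψ * √(p₁ * p₂); ψ * √(p₁ * p₂), p₂]

/-- Law of one use of a subchannel for a receiver with noise variance `v`: inputs
`(X₁, X₂) ∼ N(0, K)` and an independent noise `Z ∼ N(0, v)`. -/
def singleUseLaw (K : Matrix (Fin 2) (Fin 2) ℝ) (v : ℝ≥0) :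
    Measure (EuclideanSpace ℝ (Fin 2) × ℝ) :=
  (multivariateGaussian 0 K).prod (gaussianReal 0 v)

/-- `I(X₁ X₂; X₁ + √ρ X₂ + Z)` for `(X₁, X₂) ∼ N(0, K)` and independent `Z ∼ N(0, v)`. -/
def gaussianInfo (ρ v : ℝ≥0) (K : Matrix (Fin 2) (Fin 2) ℝ) : ℝ :=
  mutualInfo (fun s : EuclideanSpace ℝ (Fin 2) × ℝ => s.1)
    (fun s => s.1 0 + √(ρ : ℝ) * s.1 1 + s.2) (singleUseLaw K v)

/-- The values of `∑ₗ [I(X₁ₗ X₂ₗ; Yₗ) - I(X₁ₗ X₂ₗ; Y₂ₗ)]` over the jointly Gaussian inputs of the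
subchannels that satisfy the two total power constraints. -/
def gaussianSecrecyValues {L : ℕ} (ch : GaussianChannel L) (P₁ P₂ : ℝ) : Set ℝ :=
  {v | ∃ p₁ p₂ ψ : Fin L → ℝ,
    (∀ l, 0 ≤ p₁ l) ∧ (∀ l, 0 ≤ p₂ l) ∧ (∀ l, -1 ≤ ψ l ∧ ψ l ≤ 1) ∧
    ∑ l, p₁ l ≤ P₁ ∧ ∑ l, p₂ l ≤ P₂ ∧
    v = ∑ l, (gaussianInfo (ch.ρ₁ l) (ch.varDest l) (inputCov (p₁ l) (p₂ l) (ψ l))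
      - gaussianInfo (ch.ρ₂ l) (ch.varEve l) (inputCov (p₁ l) (p₂ l) (ψ l)))}

end RelayEavesdropper

end

noncomputable section

namespace RelayEavesdropper

/-! ### Two-by-two quadratic forms -/

/-! The converse is a Sato-type argument. The equivocation depends on the channel only through the
eavesdropper's marginal, and the error probability only through the destination's. So the
destination noise may be replaced by `γ Z₂ + U`, where `Z₂` is the eavesdropper noise and `U` is an
independent Gaussian of variance `u`. Giving the eavesdropper output `V` to the destination, a
Fano-type inequality (`condEntropy_le_of_density`) bounds the equivocation by the mean
log-likelihood ratio of the true law of `Y` given the inputs and `V` against any test channel from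
`V` to `Y`, plus terms that vanish after division by `n`.

The test channel is taken to be `α V + N(0, s)` on each subchannel. The mean log-ratio is then a
constant plus the second moment of `(1 - α) X₁ + (a - α b) X₂`, divided by `2 s`, with `a = √ρ₁`, `b
= √ρ₂`. If that square is at most `s (l₁ X₁² + l₂ X₂²)`, the power constraints alone bound it, for
arbitrary correlations across time, subchannels and inputs. No single-letterization is needed
(`Code.condEntropy_le`).

It remains to choose `α`, `γ`, `s`, `u` so that the bound meets the Gaussian value. The Gaussian
problem is a difference of logarithms and need not be concave, but first-order conditions at a
maximizer suffice. `exists_multipliers` extracts explicit multipliers `l₁, l₂` from perturbations of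
the inputs. `exists_tight_correlation` shows that at such a point the genie costs nothing: `γ` makes
`α` the linear mean-square estimator of `Y` from `V`, and dual feasibility gives the quadratic
domination above.

The multipliers must be positive and the budgets nonzero, so the argument is run with budgets
enlarged by `ε` and a power penalty `ε`; compactness of the feasible moments then gives `ε → 0`. The
same compactness, with the closed form `gaussianInfo_inputCov`, shows that the maximum is attained.
-/

/-- If two positive semidefinite `2 × 2` matrices have a product of trace zero, then the product
vanishes. -/
lemma mul_eq_zero_of_trace_mul_eq_zero {p r c x y z : ℝ}
    (hc : c ^ 2 ≤ p * r) (hx : 0 ≤ x) (hy : 0 ≤ y) (hz : z ^ 2 ≤ x * y)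
    (htr : x * p + y * r + 2 * z * c = 0) :
    x * p + z * c = 0 ∧ z * c + y * r = 0 ∧ x * c + z * r = 0 ∧ z * p + y * c = 0 := by
  have h1 : z ^ 2 * c ^ 2 ≤ (x * y) * (p * r) := mul_le_mul hz hc (sq_nonneg _) (by positivity)
  -- Equality case of the arithmetic-geometric mean inequality: the trace condition forces `x p + y
  -- r = 2 |z c|`, while `|z c|` is at most the geometric mean of `x p` and `y r`.
  have h2 : x * p - y * r = 0 := by
    have : (x * p - y * r) ^ 2 ≤ 0 := by
      have : x * p + y * r = -(2 * z * c) := by linarith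
      calc (x * p - y * r) ^ 2 = (x * p + y * r) ^ 2 - 4 * ((x * y) * (p * r)) := by ring
        _ = 4 * (z ^ 2 * c ^ 2) - 4 * ((x * y) * (p * r)) := by rw [this]; ring
        _ ≤ 0 := by linarith
    exact pow_eq_zero_iff two_ne_zero |>.1 (le_antisymm this (sq_nonneg _))
  have h3 : x * p + z * c = 0 := by linarith
  have h4 : z * c + y * r = 0 := by linarith
  refine ⟨h3, h4, ?_, ?_⟩
  · have : (x * c + z * r) ^ 2 ≤ 0 := by
      calc (x * c + z * r) ^ 2 = x ^ 2 * c ^ 2 + 2 * x * r * (z * c) + z ^ 2 * r ^ 2 := by ring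
        _ ≤ x ^ 2 * (p * r) + 2 * x * r * (z * c) + (x * y) * r ^ 2 := by gcongr
        _ = x * r * ((x * p + z * c) + (z * c + y * r)) := by ring
        _ = 0 := by rw [h3, h4]; ring
    exact pow_eq_zero_iff two_ne_zero |>.1 (le_antisymm this (sq_nonneg _))
  · have : (z * p + y * c) ^ 2 ≤ 0 := by
      calc (z * p + y * c) ^ 2 = z ^ 2 * p ^ 2 + 2 * y * p * (z * c) + y ^ 2 * c ^ 2 := by ring
        _ ≤ (x * y) * p ^ 2 + 2 * y * p * (z * c) + y ^ 2 * (p * r) := by gcongr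
        _ = y * p * ((x * p + z * c) + (z * c + y * r)) := by ring
        _ = 0 := by rw [h3, h4]; ring
    exact pow_eq_zero_iff two_ne_zero |>.1 (le_antisymm this (sq_nonneg _))

/-- A nonnegative binary quadratic form is positive semidefinite in the sense of its minors. -/
lemma minors_of_form_nonneg {x y z : ℝ}
    (h : ∀ s t : ℝ, 0 ≤ x * s ^ 2 + 2 * z * s * t + y * t ^ 2) :
    0 ≤ x ∧ 0 ≤ y ∧ z ^ 2 ≤ x * y := by
  refine ⟨by simpa using h 1 0, by simpa using h 0 1, ?_⟩
  have := discrim_le_zero (a := x) (b := 2 * z) (c := y) fun s => by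
    have := h s 1
    nlinarith
  unfold discrim at this
  nlinarith

/-! ### Tight genie-aided bound at a stationary point of one subchannel -/

/-- Power of `X₁ + a X₂` when `E X₁² = p`, `E X₂² = r`, `E X₁X₂ = c`. -/
def rxPower (a p r c : ℝ) : ℝ := p + a ^ 2 * r + 2 * a * c

lemma rxPower_nonneg {a p r c : ℝ} (hp : 0 ≤ p) (hr : 0 ≤ r) (hc : c ^ 2 ≤ p * r) :
    0 ≤ rxPower a p r c := by
  unfold rxPower
  rcases hp.eq_or_lt with rfl | hp
  · have : c = 0 := by
      have : c ^ 2 ≤ 0 := by simpa using hc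
      exact pow_eq_zero_iff two_ne_zero |>.1 (le_antisymm this (sq_nonneg _))
    subst this; simpa using mul_nonneg (sq_nonneg a) hr
  · have : 0 ≤ p * (p + a ^ 2 * r + 2 * a * c) := by
      nlinarith [sq_nonneg (p + a * c), mul_le_mul_of_nonneg_left hc (sq_nonneg a)]
    exact nonneg_of_mul_nonneg_right this hp

/-- Information difference, in nats, of Gaussian inputs with second moments `p`, `r`, `c`. -/
def secrecyInfo (a b v w p r c : ℝ) : ℝ :=
  (Real.log (1 + rxPower a p r c / v) - Real.log (1 + rxPower b p r c / w)) / 2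

/-- The estimator coefficient `B / (τ + C)` in the regularized problem of estimating the
destination output from the eavesdropper output. -/
def estimator (a b l₁ l₂ τ : ℝ) : ℝ :=
  (1 / l₁ + a * b / l₂) / (τ + (1 / l₁ + b ^ 2 / l₂))

lemma estimator_mul {a b l₁ l₂ τ : ℝ} (hl₁ : 0 < l₁) (hl₂ : 0 < l₂) (hτ : 0 < τ) :
    estimator a b l₁ l₂ τ * (τ + (1 / l₁ + b ^ 2 / l₂)) = 1 / l₁ + a * b / l₂ := by
  have : 0 < τ + (1 / l₁ + b ^ 2 / l₂) := by positivity
  exact div_mul_cancel₀ _ this.ne'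

/-- Write `h = (1, a)`, `g = (1, b)`, `Λ = diag (l₁, l₂)`, `K` for the moment matrix, `S`, `T` for
the two received powers and `X = hᵀ K g`. Dual feasibility says that `Λ - h hᵀ / σ + g gᵀ / τ` is
positive semidefinite, and slackness that its product with `K` has trace zero, so the product
vanishes. This determines `K h` and `K g`; pairing both with `g` gives `X = α S τ / σ` and `T = α X
τ / σ`, with `α` the estimator coefficient. -/
lemma rxPower_eq_of_stationary {a b l₁ l₂ p r c σ τ : ℝ} (hτ : 0 < τ)
    (hl₁ : 0 < l₁) (hl₂ : 0 < l₂) (hc : c ^ 2 ≤ p * r)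
    (hform : ∀ x y : ℝ, (x + a * y) ^ 2 / σ - (x + b * y) ^ 2 / τ ≤ l₁ * x ^ 2 + l₂ * y ^ 2)
    (htr : l₁ * p + l₂ * r = rxPower a p r c / σ - rxPower b p r c / τ) :
    rxPower b p r c = estimator a b l₁ l₂ τ ^ 2 * rxPower a p r c * τ ^ 2 / σ ^ 2 := by
  have hform' : ∀ x y : ℝ, 0 ≤ (l₁ - 1 / σ + 1 / τ) * x ^ 2 + 2 * (b / τ - a / σ) * x * y
      + (l₂ - a ^ 2 / σ + b ^ 2 / τ) * y ^ 2 := by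
    intro x y
    have := hform x y
    have e : (l₁ - 1 / σ + 1 / τ) * x ^ 2 + 2 * (b / τ - a / σ) * x * y
      + (l₂ - a ^ 2 / σ + b ^ 2 / τ) * y ^ 2
      = l₁ * x ^ 2 + l₂ * y ^ 2 - ((x + a * y) ^ 2 / σ - (x + b * y) ^ 2 / τ) := by
      ring
    rw [e]; linarith
  obtain ⟨hx, hy, hz⟩ := minors_of_form_nonneg hform'
  obtain ⟨e1, e2, e3, e4⟩ := mul_eq_zero_of_trace_mul_eq_zero hc hx hy hz (by
    have : (l₁ - 1 / σ + 1 / τ) * p + (l₂ - a ^ 2 / σ + b ^ 2 / τ) * r + 2 * (b / τ - a / σ) * c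
      = (l₁ * p + l₂ * r) - (rxPower a p r c / σ - rxPower b p r c / τ) := by
      rw [rxPower, rxPower]; ring
    rw [this, htr]; ring)
  have hαB := estimator_mul (a := a) (b := b) hl₁ hl₂ hτ
  have hC0 : 0 < τ + (1 / l₁ + b ^ 2 / l₂) := by positivity
  -- with `K` the moment matrix: `diag (l₁, l₂) K h = (S / σ) h - (X / τ) g`, similarly for `K g`
  have f1 : (p + a * c) = (rxPower a p r c / σ - (p + a * b * r + (a + b) * c) / τ) / l₁ := by
    rw [eq_div_iff hl₁.ne', rxPower]
    linear_combination e1 + a * e3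
  have f2 : (c + a * r)
      = (a * (rxPower a p r c / σ) - b * ((p + a * b * r + (a + b) * c) / τ)) / l₂ := by
    rw [eq_div_iff hl₂.ne', rxPower]
    linear_combination e4 + a * e2
  have f3 : (p + b * c) = ((p + a * b * r + (a + b) * c) / σ - rxPower b p r c / τ) / l₁ := by
    rw [eq_div_iff hl₁.ne', rxPower]
    linear_combination e1 + b * e3
  have f4 : (c + b * r)
      = (a * ((p + a * b * r + (a + b) * c) / σ) - b * (rxPower b p r c / τ)) / l₂ := by
    rw [eq_div_iff hl₂.ne', rxPower]
    linear_combination e4 + b * e2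
  have hT : rxPower b p r c = (p + b * c) + b * (c + b * r) := by rw [rxPower]; ring
  have hX : p + a * b * r + (a + b) * c = (p + a * c) + b * (c + a * r) := by ring
  generalize estimator a b l₁ l₂ τ = α at *
  generalize p + a * b * r + (a + b) * c = X at *
  generalize rxPower a p r c = S at *
  generalize rxPower b p r c = T at *
  have g1 : X = α * S * τ / σ := by
    have h' : X * (τ + (1 / l₁ + b ^ 2 / l₂)) = (1 / l₁ + a * b / l₂) * (S * τ / σ) := by
      rw [f1, f2] at hX
      have : X / τ * τ = X := by field_simp
      linear_combination τ * hX - (1 / l₁ + b ^ 2 / l₂) * this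
    rw [← hαB] at h'
    apply mul_right_cancel₀ hC0.ne'
    rw [h']; ring
  have g2 : T = α * X * τ / σ := by
    have h' : T * (τ + (1 / l₁ + b ^ 2 / l₂)) = (1 / l₁ + a * b / l₂) * (X * τ / σ) := by
      rw [f3, f4] at hT
      have : T / τ * τ = T := by field_simp
      linear_combination τ * hT - (1 / l₁ + b ^ 2 / l₂) * this
    rw [← hαB] at h'
    apply mul_right_cancel₀ hC0.ne'
    rw [h']; ring
  rw [g2, g1]; ring

/-- In the notation `h = (1, a)`, `g = (1, b)`, `Λ = diag (l₁, l₂)`, the left side is the `Λ⁻¹`-norm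
squared of `h - α g`, and the definition of `α` says that `(h - α g)ᵀ Λ⁻¹ g = α τ`. Testing `hform`
on `Λ⁻¹ (h - α g)` then reduces to `m² ≤ σ m` for `m = hᵀ Λ⁻¹ (h - α g)`. -/
lemma estimator_residual_le {a b l₁ l₂ σ τ : ℝ} (hσ : 0 < σ) (hτ : 0 < τ)
    (hl₁ : 0 < l₁) (hl₂ : 0 < l₂)
    (hform : ∀ x y : ℝ, (x + a * y) ^ 2 / σ - (x + b * y) ^ 2 / τ ≤ l₁ * x ^ 2 + l₂ * y ^ 2) :
    (1 - estimator a b l₁ l₂ τ) ^ 2 / l₁ + (a - estimator a b l₁ l₂ τ * b) ^ 2 / l₂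
      ≤ σ - estimator a b l₁ l₂ τ ^ 2 * τ := by
  have hαB := estimator_mul (a := a) (b := b) hl₁ hl₂ hτ
  generalize estimator a b l₁ l₂ τ = α at *
  have h := hform ((1 - α) / l₁) ((a - α * b) / l₂)
  obtain ⟨m, hm⟩ : ∃ m, m = (1 - α) / l₁ + a * ((a - α * b) / l₂) := ⟨_, rfl⟩
  have u2 : (1 - α) / l₁ + b * ((a - α * b) / l₂) = α * τ := by
    linear_combination -hαB
  have u3 : l₁ * ((1 - α) / l₁) ^ 2 + l₂ * ((a - α * b) / l₂) ^ 2
      = (1 - α) ^ 2 / l₁ + (a - α * b) ^ 2 / l₂ := by field_simp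
  have key : (1 - α) ^ 2 / l₁ + (a - α * b) ^ 2 / l₂ = m - α ^ 2 * τ := by
    rw [hm]; linear_combination -α * u2
  rw [← hm, u2, u3, key] at h
  rw [key]
  have : (α * τ) ^ 2 / τ = α ^ 2 * τ := by field_simp
  have h' : m ^ 2 / σ ≤ m := by rw [this] at h; linarith
  rw [div_le_iff₀ hσ] at h'
  have : m ≤ σ := by
    by_contra hcon
    push Not at hcon
    nlinarith
  linarith

/-- The residual bounds a sum of squares from above, so failure of positivity would force `α = 1`
and `a = b`; the defining equation of `α` would then give `τ = 0`. -/
lemma estimator_residual_pos {a b l₁ l₂ σ τ : ℝ} (hσ : 0 < σ) (hτ : 0 < τ)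
    (hl₁ : 0 < l₁) (hl₂ : 0 < l₂)
    (hform : ∀ x y : ℝ, (x + a * y) ^ 2 / σ - (x + b * y) ^ 2 / τ ≤ l₁ * x ^ 2 + l₂ * y ^ 2) :
    0 < σ - estimator a b l₁ l₂ τ ^ 2 * τ := by
  have hαB := estimator_mul (a := a) (b := b) hl₁ hl₂ hτ
  have hle := estimator_residual_le hσ hτ hl₁ hl₂ hform
  generalize estimator a b l₁ l₂ τ = α at *
  by_contra hcon
  have z1 : 0 ≤ (1 - α) ^ 2 / l₁ := by positivity
  have z2 : 0 ≤ (a - α * b) ^ 2 / l₂ := by positivity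
  have z3 : (1 - α) ^ 2 / l₁ = 0 := by linarith
  have z4 : (a - α * b) ^ 2 / l₂ = 0 := by linarith
  have z5 : α = 1 := by
    have : (1 - α) = 0 := by simpa [hl₁.ne'] using z3
    linarith
  have z6 : a = b := by
    have : (a - α * b) = 0 := by simpa [hl₂.ne'] using z4
    rw [z5] at this; linarith
  rw [z5, z6] at hαB
  have : b * b / l₂ = b ^ 2 / l₂ := by ring
  linarith

/-- Weighted Cauchy-Schwarz, with Lagrange's identity for the defect. -/
lemma sq_add_le_mul_add {l₁ l₂ d e x y : ℝ} (hl₁ : 0 < l₁) (hl₂ : 0 < l₂) :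
    (d * x + e * y) ^ 2 ≤ (d ^ 2 / l₁ + e ^ 2 / l₂) * (l₁ * x ^ 2 + l₂ * y ^ 2) := by
  have : (d ^ 2 / l₁ + e ^ 2 / l₂) * (l₁ * x ^ 2 + l₂ * y ^ 2) - (d * x + e * y) ^ 2
      = (l₂ * d * y - l₁ * e * x) ^ 2 / (l₁ * l₂) := by
    field_simp; ring
  have : 0 ≤ (l₂ * d * y - l₁ * e * x) ^ 2 / (l₁ * l₂) := by positivity
  linarith

/-- Sato-type outer bound for one subchannel. At a point `(p, r, c)` where the gradient of the
secrecy information is dominated by `diag (l₁, l₂) / 2` with complementary slackness, there is a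
noise correlation `γ` and a linear estimator `α` of the destination output from the eavesdropper
output for which the resulting genie-aided bound is tight at that point. -/
theorem exists_tight_correlation {a b v w l₁ l₂ p r c : ℝ} (hv : 0 < v) (hw : 0 < w)
    (hl₁ : 0 < l₁) (hl₂ : 0 < l₂) (hp : 0 ≤ p) (hr : 0 ≤ r) (hc : c ^ 2 ≤ p * r)
    (hform : ∀ x y : ℝ, (x + a * y) ^ 2 / (v + rxPower a p r c)
      - (x + b * y) ^ 2 / (w + rxPower b p r c) ≤ l₁ * x ^ 2 + l₂ * y ^ 2)
    (htr : l₁ * p + l₂ * r = rxPower a p r c / (v + rxPower a p r c)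
      - rxPower b p r c / (w + rxPower b p r c)) :
    ∃ α γ s u : ℝ, 0 < u ∧ 0 < s ∧ γ ^ 2 * w + u = v ∧
      (∀ x y : ℝ, ((1 - α) * x + (a - α * b) * y) ^ 2 ≤ s * (l₁ * x ^ 2 + l₂ * y ^ 2)) ∧
      Real.log (s / u) / 2 - 1 / 2 + ((γ - α) ^ 2 * w + u) / (2 * s)
        = secrecyInfo a b v w p r c - (l₁ * p + l₂ * r) / 2 := by
  have hS0 := rxPower_nonneg (a := a) hp hr hc
  have hT0 := rxPower_nonneg (a := b) hp hr hc
  obtain ⟨σ, hσ⟩ : ∃ σ, σ = v + rxPower a p r c := ⟨_, rfl⟩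
  obtain ⟨τ, hτ⟩ : ∃ τ, τ = w + rxPower b p r c := ⟨_, rfl⟩
  rw [← hσ, ← hτ] at htr hform
  have hσ0 : 0 < σ := by linarith
  have hτ0 : 0 < τ := by linarith
  have hT := rxPower_eq_of_stationary hτ0 hl₁ hl₂ hc hform htr
  have hsm := estimator_residual_le hσ0 hτ0 hl₁ hl₂ hform
  have hspos := estimator_residual_pos hσ0 hτ0 hl₁ hl₂ hform
  rw [secrecyInfo, htr]
  generalize estimator a b l₁ l₂ τ = α at *
  generalize rxPower a p r c = S at *
  generalize rxPower b p r c = T at *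
  clear hform htr
  obtain rfl : S = σ - v := by linarith
  obtain rfl : T = τ - w := by linarith
  have hST : (τ - w) * σ ^ 2 = α ^ 2 * (σ - v) * τ ^ 2 := by rw [hT]; field_simp
  -- At the Gaussian point the two noiseless signals have covariance `α S τ / σ`, as found in the
  -- proof of `rxPower_eq_of_stationary`. Adding the noise covariance `γ w` gives exactly `α τ` for
  -- this `γ`. So `α` is the linear mean-square coefficient of `Y` given the eavesdropper output,
  -- and `s = σ - α² τ` is its error.
  obtain ⟨γ, hγ⟩ : ∃ γ, γ = α * τ * v / (σ * w) := ⟨_, rfl⟩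
  have hγ' : γ * w * σ = α * τ * v := by rw [hγ]; field_simp
  have hu : σ - α ^ 2 * τ = σ * w * (v - γ ^ 2 * w) / (v * τ) := by
    rw [eq_div_iff (by positivity), hγ]
    field_simp
    linear_combination hST
  have hupos : 0 < v - γ ^ 2 * w := by
    by_contra hcon
    push Not at hcon
    have : σ - α ^ 2 * τ ≤ 0 := by
      rw [hu]
      apply div_nonpos_of_nonpos_of_nonneg _ (by positivity)
      exact mul_nonpos_of_nonneg_of_nonpos (by positivity) hcon
    linarith
  refine ⟨α, γ, σ - α ^ 2 * τ, v - γ ^ 2 * w, hupos, hspos, by ring, ?_, ?_⟩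
  · intro x y
    exact (sq_add_le_mul_add hl₁ hl₂).trans (by gcongr)
  -- The identity `hu` says `s / u = (σ / v) / (τ / w)`: the genie-aided information equals the
  -- difference of the two unaided ones.
  · have hlog : Real.log ((σ - α ^ 2 * τ) / (v - γ ^ 2 * w))
        = Real.log (1 + (σ - v) / v) - Real.log (1 + (τ - w) / w) := by
      have e1 : 1 + (σ - v) / v = σ / v := by field_simp; ring
      have e2 : 1 + (τ - w) / w = τ / w := by field_simp; ring
      rw [e1, e2, ← Real.log_div (by positivity) (by positivity), hu]
      generalize v - γ ^ 2 * w = u at *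
      congr 1
      field_simp
    obtain ⟨s, hs⟩ : ∃ s, s = σ - α ^ 2 * τ := ⟨_, rfl⟩
    have e1 : (σ - v) / σ - (τ - w) / τ = (σ - v) * s / σ ^ 2 := by
      rw [hT, hs]; field_simp
    have e2 : (γ - α) ^ 2 * w + (v - γ ^ 2 * w) = s - (σ - v) * s ^ 2 / σ ^ 2 := by
      have : (γ - α) ^ 2 * w + (v - γ ^ 2 * w) = v - 2 * α * (α * τ * v / σ) + α ^ 2 * w := by
        rw [← hγ']; field_simp; ring
      rw [this, hs]
      field_simp
      linear_combination (-α ^ 2) * hST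
    rw [← hs] at hspos
    rw [hlog, e1, e2, ← hs]
    field_simp
    ring

/-! ### First-order conditions for the Gaussian optimization problem -/

/-- Positive semidefinite matrices are closed under addition, here in terms of minors; this keeps
the perturbed moments feasible. -/
lemma add_sq_le_mul_add {p r c p' r' c' : ℝ} (hp : 0 ≤ p) (hr : 0 ≤ r) (hc : c ^ 2 ≤ p * r)
    (hp' : 0 ≤ p') (hr' : 0 ≤ r') (hc' : c' ^ 2 ≤ p' * r') :
    (c + c') ^ 2 ≤ (p + p') * (r + r') := by
  have h1 : (2 * (c * c')) ≤ p * r' + p' * r := by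
    refine abs_le_of_sq_le_sq' ?_ (by positivity) |>.2
    calc (2 * (c * c')) ^ 2 = 4 * (c ^ 2 * c' ^ 2) := by ring
      _ ≤ 4 * ((p * r) * (p' * r')) := by
        gcongr
      _ ≤ (p * r' + p' * r) ^ 2 := by nlinarith [sq_nonneg (p * r' - p' * r)]
  nlinarith

lemma nonpos_of_hasDerivAt_of_le {f : ℝ → ℝ} {d δ : ℝ} (hf : HasDerivAt f d 0) (hδ : 0 < δ)
    (hle : ∀ t, 0 < t → t < δ → f t ≤ f 0) : d ≤ 0 := by
  have h := hf.tendsto_slope_zero_right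
  refine le_of_tendsto h ?_
  filter_upwards [Ioo_mem_nhdsGT hδ] with t ht
  have := hle t ht.1 ht.2
  rw [zero_add, smul_eq_mul]
  exact mul_nonpos_of_nonneg_of_nonpos (inv_nonneg.2 ht.1.le) (by linarith)

/-- The feasible set of the Gaussian problem in terms of second moments. -/
structure IsFeasible {ι : Type*} [Fintype ι] (P₁ P₂ : ℝ) (p r c : ι → ℝ) : Prop where
  left_nonneg : ∀ l, 0 ≤ p l
  right_nonneg : ∀ l, 0 ≤ r l
  cross_sq_le : ∀ l, c l ^ 2 ≤ p l * r l
  sum_left_le : ∑ l, p l ≤ P₁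
  sum_right_le : ∑ l, r l ≤ P₂

lemma hasDerivAt_secrecyInfo {a b v w : ℝ} {p r c : ℝ → ℝ} {p' r' c' : ℝ}
    (hv : 0 < v) (hw : 0 < w) (hp : 0 ≤ p 0) (hr : 0 ≤ r 0) (hc : c 0 ^ 2 ≤ p 0 * r 0)
    (dp : HasDerivAt p p' 0) (dr : HasDerivAt r r' 0) (dc : HasDerivAt c c' 0) :
    HasDerivAt (fun t => secrecyInfo a b v w (p t) (r t) (c t))
      ((rxPower a p' r' c' / (v + rxPower a (p 0) (r 0) (c 0))
        - rxPower b p' r' c' / (w + rxPower b (p 0) (r 0) (c 0))) / 2) 0 := by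
  have key : ∀ a v : ℝ, 0 < v → HasDerivAt (fun t => Real.log (1 + rxPower a (p t) (r t) (c t) / v))
      (rxPower a p' r' c' / (v + rxPower a (p 0) (r 0) (c 0))) 0 := by
    intro a v hv
    have hS := rxPower_nonneg (a := a) hp hr hc
    have h1 : HasDerivAt (fun t => rxPower a (p t) (r t) (c t)) (rxPower a p' r' c') 0 :=
      (dp.add (dr.const_mul (a ^ 2))).add (dc.const_mul (2 * a))
    have h2 := ((h1.div_const v).const_add 1).log (by positivity)
    convert h2 using 1
    field_simp
  exact ((key a v hv).sub (key b w hw)).div_const 2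

section Multipliers

variable {ι : Type*} [Fintype ι] {a b v w p r c : ι → ℝ} {P₁ P₂ ε : ℝ}

/-- Stationarity of a maximizer along the directions that shrink the two inputs and add
independent inputs. -/
lemma stationary_of_isMax (hv : ∀ l, 0 < v l) (hw : ∀ l, 0 < w l)
    (hK : IsFeasible P₁ P₂ p r c)
    (hmax : ∀ p' r' c' : ι → ℝ, IsFeasible P₁ P₂ p' r' c' →
      ∑ l, (secrecyInfo (a l) (b l) (v l) (w l) (p' l) (r' l) (c' l) - ε * (p' l + r' l))
      ≤ ∑ l, (secrecyInfo (a l) (b l) (v l) (w l) (p l) (r l) (c l) - ε * (p l + r l)))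
    {A B : ℝ} (hA : 0 ≤ A) (hB : 0 ≤ B) {x y z : ι → ℝ} (hy : IsFeasible (A * P₁) (B * P₂) x y z) :
    ∑ l, ((rxPower (a l) (x l) (y l) (z l) / (v l + rxPower (a l) (p l) (r l) (c l))
        - rxPower (b l) (x l) (y l) (z l) / (w l + rxPower (b l) (p l) (r l) (c l))) / 2
        - ε * (x l + y l))
      ≤ A * ∑ l, (((p l + a l * c l) / (v l + rxPower (a l) (p l) (r l) (c l))
            - (p l + b l * c l) / (w l + rxPower (b l) (p l) (r l) (c l))) / 2 - ε * p l)
        + B * ∑ l, (((a l ^ 2 * r l + a l * c l) / (v l + rxPower (a l) (p l) (r l) (c l))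
            - (b l ^ 2 * r l + b l * c l) / (w l + rxPower (b l) (p l) (r l) (c l))) / 2
              - ε * r l) := by
  set pt : ι → ℝ → ℝ := fun l t => p l * (1 - t * A) + t * x l with hpt
  set rt : ι → ℝ → ℝ := fun l t => r l * (1 - t * B) + t * y l with hrt
  -- The inputs are scaled by `√(1 - tA)` and `√(1 - tB)`, so the cross moment scales by the
  -- geometric mean and the matrix stays positive semidefinite. The freed budget pays exactly for an
  -- independent input with moments `t (x, y, z)`.
  set ct : ι → ℝ → ℝ := fun l t => c l * √((1 - t * A) * (1 - t * B)) + t * z l with hct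
  have dA : ∀ A : ℝ, HasDerivAt (fun t : ℝ => 1 - t * A) (-A) 0 := fun A => by
    simpa using ((hasDerivAt_id (0 : ℝ)).mul_const A).const_sub 1
  have dp : ∀ l, HasDerivAt (pt l) (p l * (-A) + x l) 0 := fun l =>
    (((dA A).const_mul (p l)).add ((hasDerivAt_id (0 : ℝ)).mul_const (x l))).congr_deriv (by simp)
  have dr : ∀ l, HasDerivAt (rt l) (r l * (-B) + y l) 0 := fun l =>
    (((dA B).const_mul (r l)).add ((hasDerivAt_id (0 : ℝ)).mul_const (y l))).congr_deriv (by simp)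
  have dc : ∀ l, HasDerivAt (ct l) (c l * (-(A + B) / 2) + z l) 0 := fun l => by
    have h := (((dA A).mul (dA B)).sqrt (by simp)).const_mul (c l)
    refine (h.add ((hasDerivAt_id (0 : ℝ)).mul_const (z l))).congr_deriv ?_
    simp only [Pi.mul_apply, zero_mul, sub_zero, mul_one, Real.sqrt_one]
    ring
  have p0 : ∀ l, pt l 0 = p l := fun l => by simp [hpt]
  have r0 : ∀ l, rt l 0 = r l := fun l => by simp [hrt]
  have c0 : ∀ l, ct l 0 = c l := fun l => by simp [hct]
  have dF := HasDerivAt.fun_sum (u := Finset.univ) fun l (_ : l ∈ Finset.univ) =>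
    (hasDerivAt_secrecyInfo (a := a l) (b := b l) (hv l) (hw l)
      ((p0 l).symm ▸ hK.left_nonneg l) ((r0 l).symm ▸ hK.right_nonneg l)
      (by rw [p0, r0, c0]; exact hK.cross_sq_le l) (dp l) (dr l) (dc l)).sub
      (((dp l).add (dr l)).const_mul ε)
  simp only [p0, r0, c0] at dF
  -- Below this bound both factors `1 - tA` and `1 - tB` are nonnegative.
  have hδ : (0 : ℝ) < 1 / (1 + A + B) := by positivity
  have h := nonpos_of_hasDerivAt_of_le dF hδ (by
    intro t ht0 ht
    simp only [Pi.sub_apply, Pi.add_apply, p0, r0, c0]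
    rw [lt_div_iff₀ (by positivity)] at ht
    have tA : 0 ≤ 1 - t * A := by nlinarith
    have tB : 0 ≤ 1 - t * B := by nlinarith
    refine hmax (fun l => pt l t) (fun l => rt l t) (fun l => ct l t) ⟨fun l => ?_, fun l => ?_,
      fun l => ?_, ?_, ?_⟩
    · exact add_nonneg (mul_nonneg (hK.left_nonneg l) tA) (mul_nonneg ht0.le (hy.left_nonneg l))
    · exact add_nonneg (mul_nonneg (hK.right_nonneg l) tB) (mul_nonneg ht0.le (hy.right_nonneg l))
    · refine add_sq_le_mul_add (mul_nonneg (hK.left_nonneg l) tA)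
        (mul_nonneg (hK.right_nonneg l) tB) ?_ (mul_nonneg ht0.le (hy.left_nonneg l))
        (mul_nonneg ht0.le (hy.right_nonneg l)) ?_
      · rw [mul_pow, Real.sq_sqrt (mul_nonneg tA tB)]
        calc _ ≤ (p l * r l) * ((1 - t * A) * (1 - t * B)) :=
              mul_le_mul_of_nonneg_right (hK.cross_sq_le l) (mul_nonneg tA tB)
          _ = _ := by ring
      · calc (t * z l) ^ 2 = t ^ 2 * z l ^ 2 := by ring
          _ ≤ t ^ 2 * (x l * y l) := mul_le_mul_of_nonneg_left (hy.cross_sq_le l) (sq_nonneg t)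
          _ = _ := by ring
    · simp only [hpt, Finset.sum_add_distrib, ← Finset.sum_mul, ← Finset.mul_sum]
      nlinarith [hK.sum_left_le, hy.sum_left_le]
    · simp only [hrt, Finset.sum_add_distrib, ← Finset.sum_mul, ← Finset.mul_sum]
      nlinarith [hK.sum_right_le, hy.sum_right_le])
  rw [Finset.mul_sum, Finset.mul_sum, ← Finset.sum_add_distrib, ← sub_nonpos,
    ← Finset.sum_sub_distrib]
  refine le_trans (le_of_eq (Finset.sum_congr rfl fun l _ => ?_)) h
  rw [rxPower.eq_1 (a l) (p l * -A + x l), rxPower.eq_1 (b l) (p l * -A + x l),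
    rxPower.eq_1 (a l) (x l), rxPower.eq_1 (b l) (x l)]
  ring

/-- Lagrange multipliers (in doubled form) of a maximizer of the penalized Gaussian problem. -/
theorem exists_multipliers (hv : ∀ l, 0 < v l) (hw : ∀ l, 0 < w l)
    (hP₁ : 0 < P₁) (hP₂ : 0 < P₂) (hε : 0 < ε) (hK : IsFeasible P₁ P₂ p r c)
    (hmax : ∀ p' r' c' : ι → ℝ, IsFeasible P₁ P₂ p' r' c' →
      ∑ l, (secrecyInfo (a l) (b l) (v l) (w l) (p' l) (r' l) (c' l) - ε * (p' l + r' l))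
      ≤ ∑ l, (secrecyInfo (a l) (b l) (v l) (w l) (p l) (r l) (c l) - ε * (p l + r l))) :
    ∃ l₁ l₂ : ℝ, 0 < l₁ ∧ 0 < l₂ ∧
      (∀ l, ∀ x y : ℝ, (x + a l * y) ^ 2 / (v l + rxPower (a l) (p l) (r l) (c l))
        - (x + b l * y) ^ 2 / (w l + rxPower (b l) (p l) (r l) (c l))
          ≤ l₁ * x ^ 2 + l₂ * y ^ 2) ∧
      (∀ l, l₁ * p l + l₂ * r l
        = rxPower (a l) (p l) (r l) (c l) / (v l + rxPower (a l) (p l) (r l) (c l))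
          - rxPower (b l) (p l) (r l) (c l) / (w l + rxPower (b l) (p l) (r l) (c l))) ∧
      l₁ * P₁ + l₂ * P₂ ≤ ∑ l, (l₁ * p l + l₂ * r l) + 2 * ε * (P₁ + P₂) := by
  classical
  have hst := @stationary_of_isMax ι _ a b v w p r c P₁ P₂ ε hv hw hK hmax
  set E₁ := ∑ l, (((p l + a l * c l) / (v l + rxPower (a l) (p l) (r l) (c l))
            - (p l + b l * c l) / (w l + rxPower (b l) (p l) (r l) (c l))) / 2 - ε * p l) with hE₁
  set E₂ := ∑ l, (((a l ^ 2 * r l + a l * c l) / (v l + rxPower (a l) (p l) (r l) (c l))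
            - (b l ^ 2 * r l + b l * c l) / (w l + rxPower (b l) (p l) (r l) (c l))) / 2
              - ε * r l) with hE₂
  -- Shrinking only the source input, with nothing added, does not increase the objective.
  have hE₁0 : 0 ≤ E₁ := by
    have := hst (A := 1) (B := 0) zero_le_one le_rfl (x := 0) (y := 0) (z := 0)
      ⟨by simp, by simp, by simp, by simpa using hP₁.le, by simp⟩
    simpa [rxPower] using this
  have hE₂0 : 0 ≤ E₂ := by
    have := hst (A := 0) (B := 1) le_rfl zero_le_one (x := 0) (y := 0) (z := 0)
      ⟨by simp, by simp, by simp, by simp, by simpa using hP₂.le⟩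
    simpa [rxPower] using this
  have hform : ∀ l, ∀ x y : ℝ, (x + a l * y) ^ 2 / (v l + rxPower (a l) (p l) (r l) (c l))
        - (x + b l * y) ^ 2 / (w l + rxPower (b l) (p l) (r l) (c l))
          ≤ 2 * (E₁ / P₁ + ε) * x ^ 2 + 2 * (E₂ / P₂ + ε) * y ^ 2 := by
    intro l₀ x y
    -- The added input is the rank-one moment matrix of `(x, y)` on the single subchannel `l₀`; `A`
    -- and `B` are the smallest factors that pay for its powers `x²` and `y²`.
    have := hst (A := x ^ 2 / P₁) (B := y ^ 2 / P₂) (by positivity) (by positivity)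
      (x := fun l => if l = l₀ then x ^ 2 else 0) (y := fun l => if l = l₀ then y ^ 2 else 0)
      (z := fun l => if l = l₀ then x * y else 0)
      ⟨fun l => by split_ifs <;> positivity,
        fun l => by split_ifs <;> positivity,
        fun l => by split_ifs <;> simp [mul_pow], by
          simp [hP₁.ne'], by simp [hP₂.ne']⟩
    rw [Finset.sum_eq_single l₀ (fun l _ hl => by simp [hl, rxPower]) (by simp)] at this
    simp only [if_true, rxPower.eq_1 _ (x ^ 2)] at this
    have e : ∀ a : ℝ, x ^ 2 + a ^ 2 * y ^ 2 + 2 * a * (x * y) = (x + a * y) ^ 2 := fun a => by ring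
    rw [e, e] at this
    calc _ ≤ 2 * (x ^ 2 / P₁ * E₁ + y ^ 2 / P₂ * E₂ + ε * (x ^ 2 + y ^ 2)) := by linarith
      _ = _ := by ring
  set l₁ := 2 * (E₁ / P₁ + ε) with hl₁
  set l₂ := 2 * (E₂ / P₂ + ε) with hl₂
  have hl₁0 : 0 < l₁ := by positivity
  have hl₂0 : 0 < l₂ := by positivity
  have hge : ∀ l, rxPower (a l) (p l) (r l) (c l) / (v l + rxPower (a l) (p l) (r l) (c l))
          - rxPower (b l) (p l) (r l) (c l) / (w l + rxPower (b l) (p l) (r l) (c l))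
          ≤ l₁ * p l + l₂ * r l := by
    intro l
    have hp := hK.left_nonneg l
    have hr := hK.right_nonneg l
    have hc := hK.cross_sq_le l
    -- split the moment matrix into two rank-one terms
    rcases hp.eq_or_lt with hp0 | hp0
    · have hc0 : c l = 0 := by
        rw [← hp0, zero_mul] at hc
        exact pow_eq_zero_iff two_ne_zero |>.1 (le_antisymm hc (sq_nonneg _))
      have := hform l 0 √(r l)
      simp only [zero_add, mul_pow, Real.sq_sqrt hr] at this
      simpa [rxPower, hc0, ← hp0] using this
    · have h1 := hform l √(p l) (c l / √(p l))
      have h2 := hform l 0 √(r l - c l ^ 2 / p l)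
      have hsq := Real.sq_sqrt hp
      have hne : √(p l) ≠ 0 := (Real.sqrt_pos.2 hp0).ne'
      have hq : c l ^ 2 / p l ≤ r l := by rw [div_le_iff₀ hp0]; linarith
      have e1 : ∀ a : ℝ, (√(p l) + a * (c l / √(p l))) ^ 2
          = p l + 2 * a * c l + a ^ 2 * (c l ^ 2 / p l) := by
        intro a
        have : (√(p l) + a * (c l / √(p l))) ^ 2
          = √(p l) ^ 2 + 2 * a * c l * (√(p l) / √(p l)) + a ^ 2 * (c l ^ 2 / √(p l) ^ 2) := by ring
        rw [this, div_self hne, hsq]; ring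
      rw [e1, e1, div_pow, hsq] at h1
      simp only [zero_add, mul_pow, Real.sq_sqrt (sub_nonneg.2 hq)] at h2
      have := add_le_add h1 h2
      simp only [rxPower.eq_1 _ (p l)] at this ⊢
      refine le_trans (le_of_eq ?_) (this.trans (le_of_eq ?_)) <;> ring
  have hsum : ∑ l, (rxPower (a l) (p l) (r l) (c l) / (v l + rxPower (a l) (p l) (r l) (c l))
          - rxPower (b l) (p l) (r l) (c l) / (w l + rxPower (b l) (p l) (r l) (c l)))
      = 2 * (E₁ + E₂) + 2 * ε * (∑ l, p l + ∑ l, r l) := by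
    rw [hE₁, hE₂, ← Finset.sum_add_distrib, ← Finset.sum_add_distrib, Finset.mul_sum,
      Finset.mul_sum, ← Finset.sum_add_distrib]
    refine Finset.sum_congr rfl fun l _ => ?_
    rw [rxPower.eq_1 (a l), rxPower.eq_1 (b l)]
    ring
  have hlP : l₁ * P₁ + l₂ * P₂ = 2 * (E₁ + E₂) + 2 * ε * (P₁ + P₂) := by
    rw [hl₁, hl₂]; field_simp; ring
  have hle : ∑ l, (l₁ * p l + l₂ * r l) ≤ 2 * (E₁ + E₂) + 2 * ε * (∑ l, p l + ∑ l, r l) := by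
    rw [Finset.sum_add_distrib, ← Finset.mul_sum, ← Finset.mul_sum]
    have h1 : E₁ / P₁ * ∑ l, p l ≤ E₁ := by
      calc _ ≤ E₁ / P₁ * P₁ := mul_le_mul_of_nonneg_left hK.sum_left_le (by positivity)
        _ = E₁ := by field_simp
    have h2 : E₂ / P₂ * ∑ l, r l ≤ E₂ := by
      calc _ ≤ E₂ / P₂ * P₂ := mul_le_mul_of_nonneg_left hK.sum_right_le (by positivity)
        _ = E₂ := by field_simp
    rw [hl₁, hl₂]
    linarith
  refine ⟨l₁, l₂, hl₁0, hl₂0, hform, ?_, ?_⟩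
  -- Each subchannel satisfies the inequality `hge`, and the sums satisfy the reverse one, so every
  -- inequality is an equality.
  · have heq := le_antisymm (Finset.sum_le_sum fun l _ => hge l) (hle.trans hsum.ge)
    intro l
    exact ((Finset.sum_eq_sum_iff_of_le fun l _ => hge l).1 heq l (Finset.mem_univ l)).symm
  · have := hsum.symm.le.trans (Finset.sum_le_sum fun l _ => hge l)
    have h1 : 0 ≤ ∑ l, p l := Finset.sum_nonneg fun l _ => hK.left_nonneg l
    have h2 : 0 ≤ ∑ l, r l := Finset.sum_nonneg fun l _ => hK.right_nonneg l
    have h3 : 0 ≤ ε * (∑ l, p l + ∑ l, r l) := by positivity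
    linarith

end Multipliers

/-! ### A converse inequality for wiretap channels -/

section Converse

variable {Ω β : Type*} [MeasurableSpace Ω] [MeasurableSpace β] {M : ℕ} [NeZero M]
  {P : Measure Ω} [IsProbabilityMeasure P] {W : Ω → Fin M} {V : Ω → β}

/-- The posterior probability of the message `w` when `V` takes the value `y`. -/
def posterior (W : Ω → Fin M) (V : Ω → β) (P : Measure Ω) [IsFiniteMeasure P]
    (z : β × Fin M) : ℝ :=
  (condDistrib W V P z.1).real {z.2}

lemma measurable_posterior : Measurable (posterior W V P) := by
  refine measurable_from_prod_countable_left fun w => ?_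
  exact (Kernel.measurable_coe (condDistrib W V P) (MeasurableSet.singleton w)).ennreal_toReal

lemma posterior_nonneg (z : β × Fin M) : 0 ≤ posterior W V P z := measureReal_nonneg

lemma posterior_le_one (z : β × Fin M) : posterior W V P z ≤ 1 := measureReal_le_one

/-- Disintegration of the joint law over `V`; the message being finitely valued, the inner integral
is a posterior-weighted sum. -/
lemma lintegral_posterior (hW : Measurable W) (hV : Measurable V) {G : β × Fin M → ℝ≥0∞}
    (hG : Measurable G) :
    ∫⁻ ω, G (V ω, W ω) ∂P
      = ∫⁻ y, ∑ w, ENNReal.ofReal (posterior W V P (y, w)) * G (y, w) ∂(P.map V) := by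
  have h1 : ∫⁻ ω, G (V ω, W ω) ∂P = ∫⁻ z, G z ∂(P.map fun ω => (V ω, W ω)) :=
    (lintegral_map hG (hV.prodMk hW)).symm
  rw [h1, ← compProd_map_condDistrib hW.aemeasurable, Measure.lintegral_compProd hG]
  refine lintegral_congr fun y => ?_
  rw [lintegral_fintype]
  refine Finset.sum_congr rfl fun w _ => ?_
  rw [posterior, ofReal_measureReal, mul_comm]

lemma negMulLog_le_one {x : ℝ} (hx : 0 ≤ x) : Real.negMulLog x ≤ 1 := by
  rcases hx.eq_or_lt with rfl | hx
  · simp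
  · have := Real.one_sub_inv_le_log_of_pos hx
    rw [Real.negMulLog]
    have h2 : x * (1 - x⁻¹) ≤ x * Real.log x := mul_le_mul_of_nonneg_left this hx.le
    have h3 : x * (1 - x⁻¹) = x - 1 := by field_simp
    linarith

lemma integrable_log_posterior (hW : Measurable W) (hV : Measurable V) :
    Integrable (fun ω => -Real.log (posterior W V P (V ω, W ω))) P ∧
      ∫ ω, -Real.log (posterior W V P (V ω, W ω)) ∂P = condEntropy W V P * Real.log 2 := by
  have hm : Measurable fun ω => -Real.log (posterior W V P (V ω, W ω)) :=
    (Real.measurable_log.comp (measurable_posterior.comp (hV.prodMk hW))).neg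
  have hnn : ∀ z : β × Fin M, 0 ≤ -Real.log (posterior W V P z) := fun z =>
    neg_nonneg.2 (Real.log_nonpos (posterior_nonneg z) (posterior_le_one z))
  have hent : ∀ y, 0 ≤ ∑ w, Real.negMulLog (posterior W V P (y, w)) := fun y =>
    Finset.sum_nonneg fun w _ => Real.negMulLog_nonneg (posterior_nonneg _) (posterior_le_one _)
  have hlint : ∫⁻ ω, ENNReal.ofReal (-Real.log (posterior W V P (V ω, W ω))) ∂P
      = ∫⁻ y, ENNReal.ofReal (∑ w, Real.negMulLog (posterior W V P (y, w))) ∂(P.map V) := by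
    rw [lintegral_posterior (P := P) (W := W) (V := V) hW hV
      (G := fun z => ENNReal.ofReal (-Real.log (posterior W V P z)))
      ((Real.measurable_log.comp measurable_posterior).neg.ennreal_ofReal)]
    refine lintegral_congr fun y => ?_
    rw [ENNReal.ofReal_sum_of_nonneg fun w _ =>
      Real.negMulLog_nonneg (posterior_nonneg _) (posterior_le_one _)]
    refine Finset.sum_congr rfl fun w _ => ?_
    rw [← ENNReal.ofReal_mul (posterior_nonneg _), Real.negMulLog]
    congr 1; ring
  have hme : Measurable fun y => ∑ w, Real.negMulLog (posterior W V P (y, w)) :=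
    Finset.measurable_sum _ fun w _ =>
      Real.continuous_negMulLog.measurable.comp (measurable_posterior.comp measurable_prodMk_right)
  have hprob : IsProbabilityMeasure (P.map V) := Measure.isProbabilityMeasure_map hV.aemeasurable
  refine ⟨⟨hm.aestronglyMeasurable, ?_⟩, ?_⟩
  · rw [hasFiniteIntegral_iff_ofReal (Filter.Eventually.of_forall fun ω => hnn _), hlint]
    calc _ ≤ ∫⁻ _, ENNReal.ofReal M ∂(P.map V) := by
          refine lintegral_mono fun y => ENNReal.ofReal_le_ofReal ?_
          calc _ ≤ ∑ _w : Fin M, (1 : ℝ) :=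
                Finset.sum_le_sum fun w _ => negMulLog_le_one (posterior_nonneg _)
            _ = M := by simp
      _ < ∞ := by simp
  · rw [integral_eq_lintegral_of_nonneg_ae (Filter.Eventually.of_forall fun ω => hnn _)
      hm.aestronglyMeasurable, hlint, ← integral_eq_lintegral_of_nonneg_ae
      (Filter.Eventually.of_forall hent) hme.aestronglyMeasurable, condEntropy, ← integral_mul_const]
    refine integral_congr_ae (Filter.Eventually.of_forall fun y => ?_)
    have : Real.log 2 ≠ 0 := (Real.log_pos one_lt_two).ne'
    simp only [entropy, posterior]
    field_simp

/-- The event of zero posterior is weighted by that posterior in `lintegral_posterior`, so it is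
null. -/
lemma ae_posterior_pos (hW : Measurable W) (hV : Measurable V) :
    ∀ᵐ ω ∂P, 0 < posterior W V P (V ω, W ω) := by
  have hs : MeasurableSet {z : β × Fin M | posterior W V P z = 0} :=
    measurable_posterior (measurableSet_singleton 0)
  have h := lintegral_posterior (P := P) hW hV
    (G := Set.indicator {z | posterior W V P z = 0} 1) (measurable_one.indicator hs)
  have h0 : ∫⁻ ω, Set.indicator {z | posterior W V P z = 0} 1 (V ω, W ω) ∂P = (0 : ℝ≥0∞) := by
    rw [h]
    rw [← nonpos_iff_eq_zero]
    refine le_trans (lintegral_mono fun y => ?_) (le_of_eq lintegral_zero)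
    refine le_of_eq (Finset.sum_eq_zero fun w _ => ?_)
    by_cases hz : posterior W V P (y, w) = 0
    · simp [hz]
    · simp [hz]
  replace h0 := (lintegral_eq_zero_iff ((measurable_one.indicator hs).comp (hV.prodMk hW))).1 h0
  filter_upwards [h0] with ω hω
  refine lt_of_le_of_ne (posterior_nonneg _) fun hz => ?_
  have : (Set.indicator {z | posterior W V P z = 0} 1 (V ω, W ω) : ℝ≥0∞) = 1 := by
    rw [Set.indicator_of_mem (by exact hz.symm)]; rfl
  exact one_ne_zero (this.symm.trans hω)

/-- A randomized guess of the message: the decision `m` with probability one half, otherwise a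
uniform guess. -/
def guessProb (m w : Fin M) : ℝ := (if m = w then 1 / 2 else 0) + 1 / (2 * M)

lemma guessProb_pos (m w : Fin M) : 0 < guessProb m w := by
  have : (0 : ℝ) < M := Nat.cast_pos.2 (NeZero.pos M)
  unfold guessProb
  split_ifs <;> positivity

lemma sum_guessProb (m : Fin M) : ∑ w, guessProb m w = 1 := by
  have : (M : ℝ) ≠ 0 := Nat.cast_ne_zero.2 (NeZero.ne M)
  simp only [guessProb, Finset.sum_add_distrib, Finset.sum_ite_eq, Finset.mem_univ, if_true,
    Finset.sum_const, Finset.card_univ, Fintype.card_fin, nsmul_eq_mul]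
  field_simp
  norm_num

lemma neg_log_guessProb_le (m w : Fin M) :
    -Real.log (guessProb m w) ≤ Real.log 2 + if m = w then 0 else Real.log M := by
  have hM : (0 : ℝ) < M := Nat.cast_pos.2 (NeZero.pos M)
  split_ifs with h
  · have : Real.log (1 / 2) ≤ Real.log (guessProb m w) := by
      apply Real.log_le_log (by norm_num)
      rw [guessProb, if_pos h]
      have : 0 < 1 / (2 * (M : ℝ)) := by positivity
      linarith
    rw [one_div, Real.log_inv] at this
    linarith
  · have : Real.log (guessProb m w) = -(Real.log 2 + Real.log M) := by
      rw [guessProb, if_neg h, zero_add, one_div, Real.log_inv, Real.log_mul two_ne_zero hM.ne']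
    rw [this]; simp

/-- Genie-aided converse. `V` is the observation of the eavesdropper and `Y` that of the
destination; `exp ℓ` dominates the density of the law of `Y` given the inputs and `V` with respect
to a channel from `V` alone (the law of `T (V, ·)`). -/
theorem condEntropy_le_of_density {Γ Δ 𝒴 : Type*} [MeasurableSpace Γ] [MeasurableSpace Δ]
    [MeasurableSpace 𝒴] {ν : Measure Γ} [IsProbabilityMeasure ν] {ν' : Measure Δ}
    [IsProbabilityMeasure ν'] {Y : Ω × Γ → 𝒴} {T : β × Δ → 𝒴} {ℓ : Ω × Γ → ℝ} {g : 𝒴 → Fin M}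
    (hW : Measurable W) (hV : Measurable V) (hY : Measurable Y) (hT : Measurable T)
    (hℓ : Measurable ℓ) (hℓi : Integrable ℓ (P.prod ν)) (hg : Measurable g)
    (hden : ∀ ω, ∀ F : 𝒴 → ℝ≥0∞, Measurable F →
      ∫⁻ n, F (Y (ω, n)) * ENNReal.ofReal (Real.exp (-ℓ (ω, n))) ∂ν ≤ ∫⁻ u, F (T (V ω, u)) ∂ν') :
    condEntropy W V P * Real.log 2
      ≤ ∫ x, ℓ x ∂(P.prod ν) + Real.log 2
        + (P.prod ν).real {x | g (Y x) ≠ W x.1} * Real.log M := by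
  obtain ⟨hpi, hpe⟩ := integrable_log_posterior (P := P) hW hV
  have hguess : Measurable fun z : 𝒴 × Fin M => guessProb (g z.1) z.2 := by
    have : Measurable fun z : Fin M × Fin M => guessProb z.1 z.2 := measurable_of_countable _
    exact this.comp ((hg.comp measurable_fst).prodMk measurable_snd)
  -- A likelihood ratio: numerator the probability of the message under a guess from the output of
  -- the test channel, denominator its true posterior given `V`. Its mean is at most one, and `log R
  -- ≤ R - 1` then yields both the Fano term and the information term at once.
  set R : Ω × Γ → ℝ := fun x =>
    guessProb (g (Y x)) (W x.1) * Real.exp (-ℓ x) / posterior W V P (V x.1, W x.1) with hR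
  have hRm : Measurable R :=
    ((hguess.comp (hY.prodMk (hW.comp measurable_fst))).mul hℓ.neg.exp).div
      (measurable_posterior.comp ((hV.prodMk hW).comp measurable_fst))
  have hR0 : ∀ x, 0 ≤ R x := fun x =>
    div_nonneg (mul_nonneg (guessProb_pos _ _).le (Real.exp_pos _).le) (posterior_nonneg _)
  have hI : Measurable fun z : β × Fin M =>
      ∫⁻ u, ENNReal.ofReal (guessProb (g (T (z.1, u))) z.2) ∂ν' := by
    refine Measurable.lintegral_prod_right' (f := fun q : (β × Fin M) × Δ =>
      ENNReal.ofReal (guessProb (g (T (q.1.1, q.2))) q.1.2)) ?_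
    exact (hguess.comp ((hT.comp (by fun_prop : Measurable fun q : (β × Fin M) × Δ =>
      (q.1.1, q.2))).prodMk (by fun_prop : Measurable fun q : (β × Fin M) × Δ =>
        q.1.2))).ennreal_ofReal
  have hRl : ∫⁻ x, ENNReal.ofReal (R x) ∂(P.prod ν) ≤ 1 := by
    rw [lintegral_prod _ hRm.ennreal_ofReal.aemeasurable]
    calc ∫⁻ ω, ∫⁻ n, ENNReal.ofReal (R (ω, n)) ∂ν ∂P
        ≤ ∫⁻ ω, ENNReal.ofReal (1 / posterior W V P (V ω, W ω))
            * ∫⁻ u, ENNReal.ofReal (guessProb (g (T (V ω, u))) (W ω)) ∂ν' ∂P := by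
          refine lintegral_mono fun ω => ?_
          have e : ∀ n, ENNReal.ofReal (R (ω, n))
              = ENNReal.ofReal (1 / posterior W V P (V ω, W ω))
                * (ENNReal.ofReal (guessProb (g (Y (ω, n))) (W ω))
                  * ENNReal.ofReal (Real.exp (-ℓ (ω, n)))) := by
            intro n
            rw [← ENNReal.ofReal_mul (guessProb_pos _ _).le, ← ENNReal.ofReal_mul
              (div_nonneg zero_le_one (posterior_nonneg _)), hR]
            congr 1; ring
          simp only [e]
          rw [lintegral_const_mul' _ _ ENNReal.ofReal_ne_top]
          gcongr
          exact hden ω (fun y => ENNReal.ofReal (guessProb (g y) (W ω)))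
            (hguess.comp measurable_prodMk_right).ennreal_ofReal
      _ = ∫⁻ y, ∑ w, ENNReal.ofReal (posterior W V P (y, w))
            * (ENNReal.ofReal (1 / posterior W V P (y, w))
              * ∫⁻ u, ENNReal.ofReal (guessProb (g (T (y, u))) w) ∂ν') ∂(P.map V) :=
          lintegral_posterior (P := P) hW hV (G := fun z =>
            ENNReal.ofReal (1 / posterior W V P z)
              * ∫⁻ u, ENNReal.ofReal (guessProb (g (T (z.1, u))) z.2) ∂ν')
            ((measurable_const.div measurable_posterior).ennreal_ofReal.mul hI)
      _ ≤ ∫⁻ _, 1 ∂(P.map V) := by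
          refine lintegral_mono fun y => ?_
          calc _ ≤ ∑ w, ∫⁻ u, ENNReal.ofReal (guessProb (g (T (y, u))) w) ∂ν' := by
                refine Finset.sum_le_sum fun w _ => ?_
                rw [← mul_assoc, ← ENNReal.ofReal_mul (posterior_nonneg _)]
                refine mul_le_of_le_one_left' ?_
                rw [← ENNReal.ofReal_one]
                refine ENNReal.ofReal_le_ofReal ?_
                rw [mul_one_div]
                -- Only an inequality, since the quotient is `0` where the posterior vanishes.
                exact div_self_le_one _
            _ = ∫⁻ u, ∑ w, ENNReal.ofReal (guessProb (g (T (y, u))) w) ∂ν' := by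
                rw [lintegral_finsetSum]
                intro w _
                exact (hguess.comp ((hT.comp measurable_prodMk_left).prodMk
                  measurable_const)).ennreal_ofReal
            _ = ∫⁻ _, 1 ∂ν' := by
                refine lintegral_congr fun u => ?_
                rw [← ENNReal.ofReal_sum_of_nonneg fun w _ => (guessProb_pos _ _).le,
                  sum_guessProb, ENNReal.ofReal_one]
            _ ≤ 1 := by simp
      _ ≤ 1 := by
          have := Measure.isProbabilityMeasure_map (μ := P) hV.aemeasurable
          simp
  have hRi : Integrable R (P.prod ν) := by
    refine ⟨hRm.aestronglyMeasurable, ?_⟩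
    rw [hasFiniteIntegral_iff_ofReal (Filter.Eventually.of_forall hR0)]
    exact hRl.trans_lt ENNReal.one_lt_top
  have hRint : ∫ x, R x ∂(P.prod ν) ≤ 1 := by
    rw [integral_eq_lintegral_of_nonneg_ae (Filter.Eventually.of_forall hR0)
      hRm.aestronglyMeasurable]
    exact ENNReal.toReal_le_of_le_ofReal zero_le_one (by simpa using hRl)
  have herr : MeasurableSet {x : Ω × Γ | g (Y x) ≠ W x.1} :=
    (measurableSet_eq_fun (hg.comp hY) (hW.comp measurable_fst)).compl
  have hpos : ∀ᵐ x ∂(P.prod ν), 0 < posterior W V P (V x.1, W x.1) :=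
    Measure.quasiMeasurePreserving_fst.ae (ae_posterior_pos hW hV)
  have hpt : ∀ᵐ x ∂(P.prod ν), -Real.log (posterior W V P (V x.1, W x.1)) - ℓ x - Real.log 2
      - Set.indicator {x : Ω × Γ | g (Y x) ≠ W x.1} (fun _ => Real.log M) x ≤ R x - 1 := by
    filter_upwards [hpos] with x hx
    have hq := guessProb_pos (g (Y x)) (W x.1)
    have hRpos : 0 < R x := by simp only [hR]; positivity
    have h1 := Real.log_le_sub_one_of_pos hRpos
    have h2 : Real.log (R x) = Real.log (guessProb (g (Y x)) (W x.1)) - ℓ x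
        - Real.log (posterior W V P (V x.1, W x.1)) := by
      simp only [hR]
      rw [Real.log_div (by positivity) hx.ne', Real.log_mul hq.ne' (Real.exp_pos _).ne',
        Real.log_exp]
      ring
    have h3 := neg_log_guessProb_le (g (Y x)) (W x.1)
    have h4 : Set.indicator {x : Ω × Γ | g (Y x) ≠ W x.1} (fun _ => Real.log M) x
        = if g (Y x) = W x.1 then 0 else Real.log M := by
      by_cases h : g (Y x) = W x.1 <;> simp [h]
    rw [h4]
    linarith
  have hpi' : Integrable (fun x : Ω × Γ => -Real.log (posterior W V P (V x.1, W x.1)))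
      (P.prod ν) := hpi.comp_fst ν
  have hind : Integrable (Set.indicator {x : Ω × Γ | g (Y x) ≠ W x.1} fun _ => Real.log M)
      (P.prod ν) := (integrable_const _).indicator herr
  have hi₁ : Integrable (fun x : Ω × Γ => -Real.log (posterior W V P (V x.1, W x.1)) - ℓ x)
      (P.prod ν) := hpi'.sub hℓi
  have hi₂ : Integrable (fun x : Ω × Γ => -Real.log (posterior W V P (V x.1, W x.1)) - ℓ x
      - Real.log 2) (P.prod ν) := hi₁.sub (integrable_const _)
  have hmono := integral_mono_ae (hi₂.sub hind) (hRi.sub (integrable_const (1 : ℝ))) hpt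
  have e1 : ∫ x, -Real.log (posterior W V P (V x.1, W x.1)) ∂(P.prod ν)
      = condEntropy W V P * Real.log 2 := by
    rw [integral_fun_fst (fun ω => -Real.log (posterior W V P (V ω, W ω))), hpe]
    simp
  simp only [Pi.sub_apply] at hmono
  rw [integral_sub hi₂ hind, integral_sub hi₁ (integrable_const _), integral_sub hpi' hℓi,
    integral_sub hRi (integrable_const _), e1, integral_indicator_const _ herr] at hmono
  simp only [integral_const, probReal_univ, smul_eq_mul, one_mul] at hmono
  linarith

end Converse

/-! ### Gaussian densities -/

/-- The ratio of normalizing constants is kept inside the exponential as a logarithm, so that the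
log-density is the exponent itself. -/
lemma gaussianReal_eq_withDensity (m₁ m₂ : ℝ) {v₁ v₂ : ℝ≥0} (h₁ : 0 < v₁) (h₂ : 0 < v₂) :
    gaussianReal m₁ v₁ = (gaussianReal m₂ v₂).withDensity fun x => ENNReal.ofReal (Real.exp
      (Real.log (v₂ / v₁) / 2 - (x - m₁) ^ 2 / (2 * v₁) + (x - m₂) ^ 2 / (2 * v₂))) := by
  have p₁ : (0 : ℝ) < v₁ := h₁
  have p₂ : (0 : ℝ) < v₂ := h₂
  rw [gaussianReal_of_var_ne_zero _ h₁.ne', gaussianReal_of_var_ne_zero _ h₂.ne',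
    ← withDensity_mul _ (measurable_gaussianPDF _ _) (by fun_prop)]
  congr 1
  ext x
  rw [Pi.mul_apply, gaussianPDF, gaussianPDF, ← ENNReal.ofReal_mul (gaussianPDFReal_nonneg _ _ _),
    gaussianPDFReal, gaussianPDFReal]
  congr 1
  have hexp : Real.exp (Real.log (v₂ / v₁) / 2) = √(v₂ / v₁) := by
    rw [Real.sqrt_eq_rpow, Real.rpow_def_of_pos (by positivity)]
    congr 1; ring
  have e : Real.log (v₂ / v₁) / 2 - (x - m₁) ^ 2 / (2 * v₁) + (x - m₂) ^ 2 / (2 * v₂)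
      = Real.log (v₂ / v₁) / 2 + (-(x - m₁) ^ 2 / (2 * v₁)) - (-(x - m₂) ^ 2 / (2 * v₂)) := by ring
  rw [e, Real.exp_sub, Real.exp_add, hexp, Real.sqrt_div p₂.le,
    Real.sqrt_mul (by positivity : 0 ≤ 2 * Real.pi) (v₁ : ℝ),
    Real.sqrt_mul (by positivity : 0 ≤ 2 * Real.pi) (v₂ : ℝ)]
  have := Real.exp_pos (-(x - m₂) ^ 2 / (2 * v₂))
  have := Real.sqrt_pos.2 p₁
  have := Real.sqrt_pos.2 p₂
  have : 0 < √(2 * Real.pi) := Real.sqrt_pos.2 (by positivity)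
  field_simp

lemma pi_withDensity {ι : Type*} [Fintype ι] {α : ι → Type*} [∀ i, MeasurableSpace (α i)]
    (μ : ∀ i, Measure (α i)) [∀ i, IsProbabilityMeasure (μ i)] (f : ∀ i, α i → ℝ≥0∞)
    (hf : ∀ i, Measurable (f i)) [∀ i, SigmaFinite ((μ i).withDensity (f i))] :
    Measure.pi (fun i => (μ i).withDensity (f i))
      = (Measure.pi μ).withDensity fun x => ∏ i, f i (x i) := by
  refine Measure.pi_eq fun s hs => ?_
  rw [withDensity_apply _ (MeasurableSet.univ_pi hs),
    ← lintegral_indicator (MeasurableSet.univ_pi hs)]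
  have e : (Set.univ.pi s).indicator (fun x => ∏ i, f i (x i))
      = fun x => ∏ i, (s i).indicator (f i) (x i) := by
    ext x
    by_cases hx : x ∈ Set.univ.pi s
    · rw [Set.indicator_of_mem hx]
      exact Finset.prod_congr rfl fun i _ => (Set.indicator_of_mem (hx i trivial) _).symm
    · rw [Set.indicator_of_notMem hx]
      obtain ⟨i, hi⟩ : ∃ i, x i ∉ s i := by simpa using hx
      exact (Finset.prod_eq_zero (Finset.mem_univ i) (Set.indicator_of_notMem hi _)).symm
  have hm : ∀ i, Measurable ((s i).indicator (f i)) := fun i => (hf i).indicator (hs i)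
  rw [e, lintegral_prod_eq_prod_lintegral_of_indepFun Finset.univ
    (fun i (x : ∀ i, α i) => (s i).indicator (f i) (x i))
    (iIndepFun_pi (μ := μ) fun i => (hm i).aemeasurable)
    (fun i => (hm i).comp (measurable_pi_apply i))]
  refine Finset.prod_congr rfl fun i _ => ?_
  rw [withDensity_apply _ (hs i), ← lintegral_indicator (hs i),
    ← (measurePreserving_eval μ i).lintegral_comp (hm i)]

lemma map_const_add_noiseLaw {n L : ℕ} (v : Fin L → ℝ≥0) (m : Signal n L) :
    (noiseLaw n v).map (fun z => m + z)
      = Measure.pi fun i => Measure.pi fun l => gaussianReal (m i l) (v l) := by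
  have h1 : ∀ i : Fin n, (Measure.pi fun l => gaussianReal 0 (v l)).map
      (fun (z : Fin L → ℝ) => m i + z) = Measure.pi fun l => gaussianReal (m i l) (v l) := by
    intro i
    have := Measure.pi_map_pi (μ := fun l => gaussianReal 0 (v l))
      (f := fun l (z : ℝ) => m i l + z)
      (hμ := fun l => by rw [gaussianReal_map_const_add]; infer_instance)
      (fun l => (measurable_const_add _).aemeasurable)
    simp only [gaussianReal_map_const_add, zero_add] at this
    exact this
  have := Measure.pi_map_pi (μ := fun _ : Fin n => Measure.pi fun l => gaussianReal 0 (v l))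
    (f := fun i (z : Fin L → ℝ) => m i + z)
    (hμ := fun i => by rw [h1]; infer_instance)
    (fun i => (measurable_const_add _).aemeasurable)
  simp only [h1] at this
  exact this

/-- Exponent of the density of a Gaussian of mean `m` and variance `u` with respect to a Gaussian of
mean `m'` and variance `s`, at the point `m + z`. -/
def logRatio (s u m m' z : ℝ) : ℝ :=
  Real.log (s / u) / 2 - z ^ 2 / (2 * u) + (m + z - m') ^ 2 / (2 * s)

/-- The exponential weight is the density of `N(m' - m, s)` with respect to `N(0, u)` in each
coordinate. Reweighting therefore turns the true output `m + N(0, u)` into the test output `m' +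
N(0, s)`, which is the density hypothesis of `condEntropy_le_of_density`. -/
lemma lintegral_noiseLaw_logRatio {n L : ℕ} {s u : Fin L → ℝ≥0} (hs : ∀ l, 0 < s l)
    (hu : ∀ l, 0 < u l) (m m' : Signal n L) {F : Signal n L → ℝ≥0∞} (hF : Measurable F) :
    ∫⁻ z, F (m + z) * ENNReal.ofReal (Real.exp
        (-∑ i, ∑ l, logRatio (s l) (u l) (m i l) (m' i l) (z i l))) ∂(noiseLaw n u)
      = ∫⁻ z, F (m' + z) ∂(noiseLaw n s) := by
  set f : Fin n → Fin L → ℝ → ℝ≥0∞ := fun i l z =>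
    ENNReal.ofReal (Real.exp (-logRatio (s l) (u l) (m i l) (m' i l) z)) with hf
  have hfm : ∀ i l, Measurable (f i l) := fun i l => by
    simp only [hf, logRatio]; fun_prop
  have h1 : ∀ i l, (gaussianReal 0 (u l)).withDensity (f i l)
      = gaussianReal (m' i l - m i l) (s l) := by
    intro i l
    rw [gaussianReal_eq_withDensity (m' i l - m i l) 0 (hs l) (hu l)]
    congr 1
    ext z
    simp only [hf, logRatio]
    congr 2
    rw [← inv_div (u l : ℝ) (s l : ℝ), Real.log_inv]
    ring
  have h2 : ∀ i, (Measure.pi fun l => gaussianReal 0 (u l)).withDensity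
      (fun x => ∏ l, f i l (x l)) = Measure.pi fun l => gaussianReal (m' i l - m i l) (s l) := by
    intro i
    have : ∀ l, SigmaFinite ((gaussianReal 0 (u l)).withDensity (f i l)) := fun l => by
      rw [h1]; infer_instance
    rw [← pi_withDensity (fun l => gaussianReal 0 (u l)) (f i) (hfm i)]
    simp only [h1]
  have h3 : (noiseLaw n u).withDensity (fun x => ∏ i, ∏ l, f i l (x i l))
      = (noiseLaw n s).map (fun z => (m' - m) + z) := by
    have : ∀ i, SigmaFinite ((Measure.pi fun l => gaussianReal 0 (u l)).withDensity
      (fun x => ∏ l, f i l (x l))) := fun i => by rw [h2]; infer_instance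
    rw [map_const_add_noiseLaw, noiseLaw, ← pi_withDensity
      (fun _ : Fin n => Measure.pi fun l => gaussianReal 0 (u l)) (fun i x => ∏ l, f i l (x l))
      (fun i => Finset.measurable_prod _ fun l _ => (hfm i l).comp (measurable_pi_apply l))]
    simp only [h2, Pi.sub_apply]
  have hprod : ∀ z : Signal n L, ENNReal.ofReal (Real.exp
      (-∑ i, ∑ l, logRatio (s l) (u l) (m i l) (m' i l) (z i l))) = ∏ i, ∏ l, f i l (z i l) := by
    intro z
    simp only [hf]
    rw [← Finset.sum_neg_distrib, Real.exp_sum, ENNReal.ofReal_prod_of_nonneg fun i _ =>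
      (Real.exp_pos _).le]
    refine Finset.prod_congr rfl fun i _ => ?_
    rw [← Finset.sum_neg_distrib, Real.exp_sum, ENNReal.ofReal_prod_of_nonneg fun i _ =>
      (Real.exp_pos _).le]
  have hpm : Measurable fun z : Signal n L => ∏ i, ∏ l, f i l (z i l) :=
    Finset.measurable_prod _ fun i _ => Finset.measurable_prod _ fun l _ =>
      (hfm i l).comp ((measurable_pi_apply l).comp (measurable_pi_apply i))
  have hFm : Measurable fun z : Signal n L => F (m + z) := hF.comp (measurable_const_add m)
  calc _ = ∫⁻ z, ((fun z : Signal n L => ∏ i, ∏ l, f i l (z i l)) * fun z => F (m + z)) z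
        ∂(noiseLaw n u) := by
        refine lintegral_congr fun z => ?_
        rw [hprod, Pi.mul_apply, mul_comm]
    _ = ∫⁻ z, F (m + z) ∂((noiseLaw n s).map (fun z => (m' - m) + z)) := by
        rw [← lintegral_withDensity_eq_lintegral_mul _ hpm hFm, h3]
    _ = _ := by
        rw [lintegral_map hFm (measurable_const_add _)]
        refine lintegral_congr fun z => ?_
        congr 1
        abel

/-! ### Moments and sums of the noise -/

lemma measurePreserving_noise_apply {n L : ℕ} (v : Fin L → ℝ≥0) (i : Fin n) (l : Fin L) :
    MeasurePreserving (fun z : Signal n L => z i l) (noiseLaw n v) (gaussianReal 0 (v l)) :=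
  (measurePreserving_eval (fun l => gaussianReal 0 (v l)) l).comp
    (measurePreserving_eval (fun _ : Fin n => Measure.pi fun l => gaussianReal 0 (v l)) i)

lemma memLp_noise {n L : ℕ} (v : Fin L → ℝ≥0) (i : Fin n) (l : Fin L) :
    MemLp (fun z : Signal n L => z i l) 2 (noiseLaw n v) :=
  (memLp_id_gaussianReal' (μ := 0) (v := v l) 2 (by simp)).comp_measurePreserving
    (measurePreserving_noise_apply v i l)

lemma integral_noise {n L : ℕ} (v : Fin L → ℝ≥0) (i : Fin n) (l : Fin L) :
    ∫ z : Signal n L, z i l ∂(noiseLaw n v) = 0 := by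
  have h := measurePreserving_noise_apply v i l
  have := integral_map (μ := noiseLaw n v) h.measurable.aemeasurable (f := fun x : ℝ => x)
    measurable_id.aestronglyMeasurable
  rw [h.map_eq, integral_id_gaussianReal] at this
  exact this.symm

lemma integral_sq_gaussianReal (v : ℝ≥0) : ∫ x, x ^ 2 ∂(gaussianReal 0 v) = v := by
  have := variance_fun_id_gaussianReal (μ := 0) (v := v)
  rwa [variance_of_integral_eq_zero (by fun_prop) integral_id_gaussianReal] at this

lemma integral_noise_sq {n L : ℕ} (v : Fin L → ℝ≥0) (i : Fin n) (l : Fin L) :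
    ∫ z : Signal n L, z i l ^ 2 ∂(noiseLaw n v) = v l := by
  have h := measurePreserving_noise_apply v i l
  have := integral_map (μ := noiseLaw n v) h.measurable.aemeasurable (f := fun x : ℝ => x ^ 2)
    (by fun_prop)
  rw [h.map_eq, integral_sq_gaussianReal] at this
  exact this.symm

lemma map_prod_gaussianReal_add_mul (γ : ℝ) {u v w : ℝ≥0} (h : γ ^ 2 * w + u = (v : ℝ)) :
    ((gaussianReal 0 w).prod (gaussianReal 0 u)).map (fun q => γ * q.1 + q.2)
      = gaussianReal 0 v := by
  have e : (fun q : ℝ × ℝ => γ * q.1 + q.2)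
      = (fun q : ℝ × ℝ => q.1 + q.2) ∘ Prod.map (fun x => γ * x) id := by ext; simp
  rw [e, ← Measure.map_map (by fun_prop) (by fun_prop), ← Measure.map_prod_map _ _ (by fun_prop)
    (by fun_prop), Measure.map_id, gaussianReal_map_const_mul]
  have := gaussianReal_conv_gaussianReal (m₁ := γ * 0) (m₂ := 0)
    (v₁ := .mk (γ ^ 2) (sq_nonneg γ) * w) (v₂ := u)
  rw [Measure.conv] at this
  rw [this]
  congr 1
  · simp
  · ext; simpa using h

/-! ### Measure-preserving rearrangements -/

/-- This is the Sato coupling: the destination noise is realized as a multiple of the eavesdropper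
noise plus an independent remainder. -/
lemma measurePreserving_noise_add {n L : ℕ} (γ : Fin L → ℝ) {u v w : Fin L → ℝ≥0}
    (h : ∀ l, γ l ^ 2 * w l + u l = (v l : ℝ)) :
    MeasurePreserving (fun q : Signal n L × Signal n L => fun i l => γ l * q.1 i l + q.2 i l)
      ((noiseLaw n w).prod (noiseLaw n u)) (noiseLaw n v) := by
  have h1 : ∀ l, MeasurePreserving (fun q : ℝ × ℝ => γ l * q.1 + q.2)
      ((gaussianReal 0 (w l)).prod (gaussianReal 0 (u l))) (gaussianReal 0 (v l)) := fun l =>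
    ⟨by fun_prop, map_prod_gaussianReal_add_mul _ (h l)⟩
  have h2 := (measurePreserving_pi _ _ h1).comp (measurePreserving_arrowProdEquivProdArrow ℝ ℝ
    (Fin L) (fun l => gaussianReal 0 (w l)) (fun l => gaussianReal 0 (u l))).symm
  exact (measurePreserving_pi _ _ fun _ : Fin n => h2).comp
    (measurePreserving_arrowProdEquivProdArrow (Fin L → ℝ) (Fin L → ℝ) (Fin n)
      (fun _ => Measure.pi fun l => gaussianReal 0 (w l))
      (fun _ => Measure.pi fun l => gaussianReal 0 (u l))).symm

lemma measurePreserving_regroup {α β γ δ : Type*} [MeasurableSpace α] [MeasurableSpace β]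
    [MeasurableSpace γ] [MeasurableSpace δ] (A : Measure α) (B : Measure β) (C : Measure γ)
    (D : Measure δ) [SFinite A] [SFinite B] [SFinite C] [SFinite D] :
    MeasurePreserving (fun x : α × β × γ × δ => ((x.1, x.2.1, x.2.2.1), x.2.2.2))
      (A.prod (B.prod (C.prod D))) ((A.prod (B.prod C)).prod D) :=
  (measurePreserving_prodAssoc A (B.prod C) D).symm.comp
    ((MeasurePreserving.id A).prod (measurePreserving_prodAssoc B C D).symm)

/-- Conditional entropy depends only on the joint law of `V` and `W`; this permits moving to a space
without the original destination noise. -/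
lemma condEntropy_comp {Ω Ω' β : Type*} [MeasurableSpace Ω] [MeasurableSpace Ω']
    [MeasurableSpace β] {M : ℕ} [NeZero M] {μ : Measure Ω} [IsFiniteMeasure μ] {P : Measure Ω'}
    [IsFiniteMeasure P] {φ : Ω → Ω'} (hφ : MeasurePreserving φ μ P) {W : Ω' → Fin M}
    {V : Ω' → β} (hW : Measurable W) (hV : Measurable V) :
    condEntropy (W ∘ φ) (V ∘ φ) μ = condEntropy W V P := by
  have h1 : μ.map (V ∘ φ) = P.map V := by
    rw [← Measure.map_map hV hφ.measurable, hφ.map_eq]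
  have h2 : (μ.map fun ω => ((V ∘ φ) ω, (W ∘ φ) ω)) = P.map fun ω => (V ω, W ω) := by
    rw [← hφ.map_eq, Measure.map_map (hV.prodMk hW) hφ.measurable]
    rfl
  have h3 : condDistrib (W ∘ φ) (V ∘ φ) μ = condDistrib W V P := by
    rw [condDistrib, condDistrib]
    congr 1
  rw [condEntropy, condEntropy, h1, h3]

/-- Second moment of a sum of independent square-integrable variables, one of them centered. -/
lemma integral_add_sq_prod {α β : Type*} [MeasurableSpace α] [MeasurableSpace β] {μ : Measure α}
    {ν : Measure β} [IsProbabilityMeasure μ] [IsProbabilityMeasure ν] {f : α → ℝ} {g : β → ℝ}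
    (hf : MemLp f 2 μ) (hg : MemLp g 2 ν) (hg0 : ∫ y, g y ∂ν = 0) :
    MemLp (fun x : α × β => f x.1 + g x.2) 2 (μ.prod ν) ∧
      ∫ x, (f x.1 + g x.2) ^ 2 ∂(μ.prod ν) = ∫ x, f x ^ 2 ∂μ + ∫ y, g y ^ 2 ∂ν := by
  have hf' : MemLp (fun x : α × β => f x.1) 2 (μ.prod ν) := hf.comp_fst ν
  have hg' : MemLp (fun x : α × β => g x.2) 2 (μ.prod ν) := hg.comp_snd μ
  refine ⟨hf'.add hg', ?_⟩
  have hfg : Integrable (fun x : α × β => f x.1 * g x.2) (μ.prod ν) := hf'.integrable_mul hg'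
  have e : ∀ x : α × β, (f x.1 + g x.2) ^ 2 = f x.1 ^ 2 + g x.2 ^ 2 + 2 * (f x.1 * g x.2) :=
    fun x => by ring
  have i1 : Integrable (fun x : α × β => f x.1 ^ 2 + g x.2 ^ 2) (μ.prod ν) :=
    hf'.integrable_sq.add hg'.integrable_sq
  simp only [e]
  rw [integral_add i1 (hfg.const_mul 2), integral_add hf'.integrable_sq hg'.integrable_sq,
    integral_const_mul, integral_prod_mul, hg0, integral_fun_fst (fun x => f x ^ 2),
    integral_fun_snd (fun y => g y ^ 2)]
  simp

/-! ### Genie-aided equivocation bound for a code -/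

namespace Code

variable {L n M : ℕ} (c : Code L n M) (ch : GaussianChannel L)

/-- Message, source input, relay randomness and relay noise. -/
abbrev Inputs (L n M : ℕ) : Type := (Fin M × Signal n L) × ℝ × Signal n L

/-- Joint law of the message, the source input, the relay randomness and the relay noise. -/
def inputsLaw : Measure (Inputs L n M) :=
  (uniformOn (Set.univ : Set (Fin M)) ⊗ₘ c.source).prod
    (c.seedLaw.prod (noiseLaw n ch.varRelay))

instance [NeZero M] : IsProbabilityMeasure (c.inputsLaw ch) := by
  unfold inputsLaw; infer_instance

/-- The relay input as a function of the inputs of the transmission. -/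
def relayInputOf (b : Inputs L n M) : Signal n L :=
  fun i => c.relay i b.2.1 fun j l =>
    b.1.2 (Fin.castLE i.2.le j) l + b.2.2 (Fin.castLE i.2.le j) l

lemma measurable_relayInputOf (i : Fin n) (l : Fin L) :
    Measurable fun b : Inputs L n M => c.relayInputOf b i l :=
  (measurable_pi_apply l).comp ((c.measurable_relay i).comp
    ((by fun_prop : Measurable fun b : Inputs L n M => (b.2.1, fun (j : Fin i) (l : Fin L) =>
      b.1.2 (Fin.castLE i.2.le j) l + b.2.2 (Fin.castLE i.2.le j) l))))

lemma measurePreserving_inputs_noises [NeZero M] :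
    MeasurePreserving (fun ω : Sample L n M => (((ω.1, ω.2.1, ω.2.2.1), ω.2.2.2) :
      Inputs L n M × Signal n L × Signal n L)) (c.law ch)
      ((c.inputsLaw ch).prod ((noiseLaw n ch.varDest).prod (noiseLaw n ch.varEve))) :=
  measurePreserving_regroup _ _ _ _

lemma measurePreserving_inputs_dest [NeZero M] :
    MeasurePreserving (fun ω : Sample L n M => (((ω.1, ω.2.1, ω.2.2.1), ω.2.2.2.1) :
      Inputs L n M × Signal n L)) (c.law ch)
      ((c.inputsLaw ch).prod (noiseLaw n ch.varDest)) :=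
  ((MeasurePreserving.id _).prod measurePreserving_fst).comp
    (c.measurePreserving_inputs_noises ch)

lemma measurePreserving_inputs_eve [NeZero M] :
    MeasurePreserving (fun ω : Sample L n M => (((ω.1, ω.2.1, ω.2.2.1), ω.2.2.2.2) :
      Inputs L n M × Signal n L)) (c.law ch)
      ((c.inputsLaw ch).prod (noiseLaw n ch.varEve)) :=
  ((MeasurePreserving.id _).prod measurePreserving_snd).comp
    (c.measurePreserving_inputs_noises ch)

lemma measurePreserving_inputs [NeZero M] :
    MeasurePreserving (fun ω : Sample L n M => ((ω.1, ω.2.1, ω.2.2.1) : Inputs L n M))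
      (c.law ch) (c.inputsLaw ch) :=
  measurePreserving_fst.comp (c.measurePreserving_inputs_noises ch)

/-- Noiseless part `x₁ + a x₂` of a received signal. -/
def mix (a : Fin L → ℝ) (b : Inputs L n M) : Signal n L :=
  fun i l => b.1.2 i l + a l * c.relayInputOf b i l

lemma measurable_mix (a : Fin L → ℝ) : Measurable (c.mix a) := by
  have := c.measurable_relayInputOf
  exact measurable_pi_lambda _ fun i => measurable_pi_lambda _ fun l =>
    (by fun_prop : Measurable fun b : Inputs L n M => b.1.2 i l).add ((this i l).const_mul _)

/-- A finite bound on the lower integrals forces square integrability, so the power constraints pass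
to Bochner integrals, with no default value `0` for a nonintegrable square. -/
lemma memLp_of_sum_lintegral_sq_le {Ω ι κ : Type*} [Fintype ι] [Fintype κ] [MeasurableSpace Ω]
    {μ : Measure Ω} {X : ι → κ → Ω → ℝ} (hX : ∀ i k, Measurable (X i k)) {A : ℝ} (hA : 0 ≤ A)
    (h : ∑ i, ∑ k, ∫⁻ ω, ENNReal.ofReal (X i k ω ^ 2) ∂μ ≤ ENNReal.ofReal A) :
    (∀ i k, MemLp (X i k) 2 μ) ∧ ∑ i, ∑ k, ∫ ω, X i k ω ^ 2 ∂μ ≤ A := by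
  have hfin : ∀ i k, ∫⁻ ω, ENNReal.ofReal (X i k ω ^ 2) ∂μ < ∞ := fun i k =>
    lt_of_le_of_lt ((Finset.single_le_sum (f := fun k => ∫⁻ ω, ENNReal.ofReal (X i k ω ^ 2) ∂μ)
      (fun _ _ => zero_le) (Finset.mem_univ k)).trans
      ((Finset.single_le_sum (f := fun i => ∑ k, ∫⁻ ω, ENNReal.ofReal (X i k ω ^ 2) ∂μ)
        (fun _ _ => zero_le) (Finset.mem_univ i)).trans h)) ENNReal.ofReal_lt_top
  have hint : ∀ i k, ENNReal.ofReal (∫ ω, X i k ω ^ 2 ∂μ)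
      = ∫⁻ ω, ENNReal.ofReal (X i k ω ^ 2) ∂μ := fun i k => by
    rw [integral_eq_lintegral_of_nonneg_ae (Filter.Eventually.of_forall fun ω => sq_nonneg _)
      ((hX i k).pow_const 2).aestronglyMeasurable, ENNReal.ofReal_toReal (hfin i k).ne]
  refine ⟨fun i k => ?_, ?_⟩
  · rw [memLp_two_iff_integrable_sq (hX i k).aestronglyMeasurable]
    refine ⟨((hX i k).pow_const 2).aestronglyMeasurable, ?_⟩
    rw [hasFiniteIntegral_iff_ofReal (Filter.Eventually.of_forall fun ω => sq_nonneg _)]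
    exact hfin i k
  · rw [← ENNReal.ofReal_le_ofReal_iff hA, ENNReal.ofReal_sum_of_nonneg fun i _ =>
      Finset.sum_nonneg fun k _ => integral_nonneg fun ω => sq_nonneg _]
    refine le_trans (le_of_eq (Finset.sum_congr rfl fun i _ => ?_)) h
    rw [ENNReal.ofReal_sum_of_nonneg fun k _ => integral_nonneg fun ω => sq_nonneg _]
    exact Finset.sum_congr rfl fun k _ => hint i k

/-- Expectation of the log-density ratio at one channel use, with `A` the signal component that
the linear estimator leaves. -/
lemma integral_logRatio {Ω : Type*} [MeasurableSpace Ω] {P : Measure Ω} [IsProbabilityMeasure P]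
    {w u : Fin L → ℝ≥0} {s : ℝ} (l : Fin L) (i : Fin n) (hu : 0 < u l)
    {α γ : ℝ} {m₁ m₂ A : Ω → ℝ} (hA : ∀ b, A b = m₁ b - α * m₂ b) (hA2 : MemLp A 2 P) :
    Integrable (fun x : (Ω × Signal n L) × Signal n L =>
      logRatio s (u l) (m₁ x.1.1 + γ * x.1.2 i l) (α * (m₂ x.1.1 + x.1.2 i l)) (x.2 i l))
      ((P.prod (noiseLaw n w)).prod (noiseLaw n u)) ∧
    ∫ x : (Ω × Signal n L) × Signal n L,
      logRatio s (u l) (m₁ x.1.1 + γ * x.1.2 i l) (α * (m₂ x.1.1 + x.1.2 i l)) (x.2 i l)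
      ∂((P.prod (noiseLaw n w)).prod (noiseLaw n u))
      = Real.log (s / u l) / 2 - 1 / 2
        + (∫ b, A b ^ 2 ∂P + (γ - α) ^ 2 * w l + u l) / (2 * s) := by
  have hu' : (u l : ℝ) ≠ 0 := by exact_mod_cast hu.ne'
  obtain ⟨h1, e1⟩ := integral_add_sq_prod hA2 ((memLp_noise w i l).const_mul (γ - α))
    (by rw [integral_const_mul, integral_noise, mul_zero])
  obtain ⟨h2, e2⟩ := integral_add_sq_prod h1 (memLp_noise u i l) (integral_noise u i l)
  have hn : MemLp (fun x : (Ω × Signal n L) × Signal n L => x.2 i l) 2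
      ((P.prod (noiseLaw n w)).prod (noiseLaw n u)) := (memLp_noise u i l).comp_snd _
  -- The estimation error splits into three independent parts: the residual signal `A`, the
  -- eavesdropper noise with coefficient `γ - α`, and the remainder noise.
  have e : ∀ x : (Ω × Signal n L) × Signal n L,
      logRatio s (u l) (m₁ x.1.1 + γ * x.1.2 i l) (α * (m₂ x.1.1 + x.1.2 i l)) (x.2 i l)
      = (Real.log (s / u l) / 2 - x.2 i l ^ 2 / (2 * u l))
        + (A x.1.1 + (γ - α) * x.1.2 i l + x.2 i l) ^ 2 / (2 * s) := by
    intro x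
    rw [logRatio, hA]
    ring
  simp only [e]
  have i1 : Integrable (fun x : (Ω × Signal n L) × Signal n L =>
      Real.log (s / u l) / 2 - x.2 i l ^ 2 / (2 * (u l : ℝ)))
      ((P.prod (noiseLaw n w)).prod (noiseLaw n u)) :=
    (integrable_const _).sub (hn.integrable_sq.div_const _)
  have i2 := h2.integrable_sq.div_const (2 * s)
  refine ⟨i1.add i2, ?_⟩
  rw [integral_add i1 i2, integral_sub (integrable_const _) (hn.integrable_sq.div_const _),
    integral_div, integral_div, integral_div, e2, e1,
    integral_fun_snd (fun z : Signal n L => z i l ^ 2),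
    integral_noise_sq]
  simp only [mul_pow, integral_const_mul, integral_noise_sq, integral_const, probReal_univ,
    smul_eq_mul, one_mul]
  field_simp

end Code

namespace Code

variable {L n M : ℕ} [NeZero M] (c : Code L n M) (ch : GaussianChannel L)

/-- The inputs satisfy the power constraints in terms of Bochner integrals. -/
lemma moments_of_satisfiesPower {P₁ P₂ : ℝ} (hP₁ : 0 ≤ P₁) (hP₂ : 0 ≤ P₂)
    (h : c.SatisfiesPower ch P₁ P₂) :
    ((∀ l i, MemLp (fun b : Inputs L n M => b.1.2 i l) 2 (c.inputsLaw ch)) ∧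
      ∑ l, ∑ i, ∫ b, b.1.2 i l ^ 2 ∂(c.inputsLaw ch) ≤ n * P₁) ∧
    ((∀ l i, MemLp (fun b => c.relayInputOf b i l) 2 (c.inputsLaw ch)) ∧
      ∑ l, ∑ i, ∫ b, c.relayInputOf b i l ^ 2 ∂(c.inputsLaw ch) ≤ n * P₂) := by
  have hmp := c.measurePreserving_inputs ch
  have m1 : ∀ (l : Fin L) (i : Fin n), Measurable fun b : Inputs L n M => b.1.2 i l :=
    fun l i => by fun_prop
  have m2 : ∀ (l : Fin L) (i : Fin n), Measurable fun b => c.relayInputOf b i l :=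
    fun l i => c.measurable_relayInputOf i l
  refine ⟨memLp_of_sum_lintegral_sq_le m1 (by positivity) (le_trans (le_of_eq ?_) h.1),
    memLp_of_sum_lintegral_sq_le m2 (by positivity) (le_trans (le_of_eq ?_) h.2)⟩
  · refine Finset.sum_congr rfl fun l _ => Finset.sum_congr rfl fun i _ => ?_
    exact (hmp.lintegral_comp ((m1 l i).pow_const 2).ennreal_ofReal).symm
  · refine Finset.sum_congr rfl fun l _ => Finset.sum_congr rfl fun i _ => ?_
    exact (hmp.lintegral_comp ((m2 l i).pow_const 2).ennreal_ofReal).symm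

/-- Genie-aided bound on the equivocation of a code: the noises of the destination and of the
eavesdropper are correlated through `γ`, and the destination output is estimated linearly, with
coefficient `α`, from the eavesdropper output. -/
theorem condEntropy_le {P₁ P₂ l₁ l₂ : ℝ} (hP₁ : 0 ≤ P₁) (hP₂ : 0 ≤ P₂)
    (hl₁ : 0 ≤ l₁) (hl₂ : 0 ≤ l₂) (hpow : c.SatisfiesPower ch P₁ P₂)
    {α γ D : Fin L → ℝ} {s u : Fin L → ℝ≥0} (hs : ∀ l, 0 < s l) (hu : ∀ l, 0 < u l)
    (hvar : ∀ l, γ l ^ 2 * ch.varEve l + u l = (ch.varDest l : ℝ))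
    (hquad : ∀ l, ∀ x y : ℝ, ((1 - α l) * x + (√(ch.ρ₁ l : ℝ) - α l * √(ch.ρ₂ l : ℝ)) * y) ^ 2
      ≤ s l * (l₁ * x ^ 2 + l₂ * y ^ 2))
    (hval : ∀ l, Real.log (s l / u l) / 2 - 1 / 2
      + ((γ l - α l) ^ 2 * ch.varEve l + u l) / (2 * s l) ≤ D l) :
    condEntropy message (c.eveOutput ch) (c.law ch) * Real.log 2
      ≤ n * (∑ l, D l + (l₁ * P₁ + l₂ * P₂) / 2) + Real.log 2
        + c.errorProb ch * Real.log M := by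
  obtain ⟨⟨hX₁, hS₁⟩, hX₂, hS₂⟩ := c.moments_of_satisfiesPower ch hP₁ hP₂ hpow
  set a : Fin L → ℝ := fun l => √(ch.ρ₁ l : ℝ) with ha
  set b : Fin L → ℝ := fun l => √(ch.ρ₂ l : ℝ) with hb
  set W : Inputs L n M × Signal n L → Fin M := fun x => x.1.1.1 with hW
  set V : Inputs L n M × Signal n L → Signal n L := fun x => c.mix b x.1 + x.2 with hV
  set Y : (Inputs L n M × Signal n L) × Signal n L → Signal n L := fun x =>
    (fun i l => c.mix a x.1.1 i l + γ l * x.1.2 i l) + x.2 with hY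
  set T : Signal n L × Signal n L → Signal n L := fun x => (fun i l => α l * x.1 i l) + x.2 with hT
  set ℓ : (Inputs L n M × Signal n L) × Signal n L → ℝ := fun x =>
    ∑ i, ∑ l, logRatio (s l) (u l) (c.mix a x.1.1 i l + γ l * x.1.2 i l)
      (α l * (c.mix b x.1.1 i l + x.1.2 i l)) (x.2 i l) with hℓ
  have hWm : Measurable W := by fun_prop
  have hma := c.measurable_mix a
  have hmb := c.measurable_mix b
  have hmai : ∀ i l, Measurable fun x => c.mix a x i l := fun i l =>
    (measurable_pi_apply l).comp ((measurable_pi_apply i).comp hma)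
  have hmbi : ∀ i l, Measurable fun x => c.mix b x i l := fun i l =>
    (measurable_pi_apply l).comp ((measurable_pi_apply i).comp hmb)
  have hVm : Measurable V := (hmb.comp measurable_fst).add measurable_snd
  have hYm : Measurable Y := by
    refine Measurable.add (measurable_pi_lambda _ fun i => measurable_pi_lambda _ fun l => ?_)
      measurable_snd
    exact ((hmai i l).comp (measurable_fst.comp measurable_fst)).add (by fun_prop)
  have hTm : Measurable T := by fun_prop
  have hA : ∀ i l x, (1 - α l) * x.1.2 i l + (a l - α l * b l) * c.relayInputOf x i l
      = c.mix a x i l - α l * c.mix b x i l := fun i l x => by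
    simp only [mix]; ring
  have hA2 : ∀ i l, MemLp (fun x : Inputs L n M =>
      (1 - α l) * x.1.2 i l + (a l - α l * b l) * c.relayInputOf x i l) 2 (c.inputsLaw ch) :=
    fun i l => ((hX₁ l i).const_mul _).add ((hX₂ l i).const_mul _)
  have hlr := fun i l => integral_logRatio (w := ch.varEve) (u := u) (s := s l) (n := n) l i (hu l)
    (α := α l) (γ := γ l) (hA i l) (hA2 i l)
  have hℓi : Integrable ℓ (((c.inputsLaw ch).prod (noiseLaw n ch.varEve)).prod (noiseLaw n u)) :=
    integrable_finsetSum _ fun i _ => integrable_finsetSum _ fun l _ => (hlr i l).1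
  have hℓm : Measurable ℓ := by
    refine Finset.measurable_sum _ fun i _ => Finset.measurable_sum _ fun l _ => ?_
    have h1 : Measurable fun x : (Inputs L n M × Signal n L) × Signal n L => c.mix a x.1.1 i l :=
      (hmai i l).comp (measurable_fst.comp measurable_fst)
    have h2 : Measurable fun x : (Inputs L n M × Signal n L) × Signal n L => c.mix b x.1.1 i l :=
      (hmbi i l).comp (measurable_fst.comp measurable_fst)
    unfold logRatio
    fun_prop
  have hbound := condEntropy_le_of_density (P := (c.inputsLaw ch).prod (noiseLaw n ch.varEve))
    (ν := noiseLaw n u) (ν' := noiseLaw n s) hWm hVm hYm hTm hℓm hℓi c.measurable_decoder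
    (fun ω F hF => (lintegral_noiseLaw_logRatio hs hu
      (fun i l => c.mix a ω.1 i l + γ l * ω.2 i l) (fun i l => α l * V ω i l) hF).le)
  -- Only the inputs and the eavesdropper noise enter here, so the new correlation of the noises is
  -- invisible.
  have hent : condEntropy message (c.eveOutput ch) (c.law ch)
      = condEntropy W V ((c.inputsLaw ch).prod (noiseLaw n ch.varEve)) :=
    condEntropy_comp (c.measurePreserving_inputs_eve ch) hWm hVm
  -- The decoder sees only the inputs and `γ Z₂ + U`, which together have the same law as the inputs
  -- and the original destination noise.
  have herr : (((c.inputsLaw ch).prod (noiseLaw n ch.varEve)).prod (noiseLaw n u)).real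
      {x | c.decoder (Y x) ≠ W x.1} = c.errorProb ch := by
    have hset : MeasurableSet {q : Inputs L n M × Signal n L |
        c.decoder (c.mix a q.1 + q.2) ≠ q.1.1.1} :=
      (measurableSet_eq_fun (c.measurable_decoder.comp
        ((hma.comp measurable_fst).add measurable_snd)) (by fun_prop)).compl
    have h1 := ((MeasurePreserving.id (c.inputsLaw ch)).prod
      (measurePreserving_noise_add (n := n) γ hvar)).comp
      (measurePreserving_prodAssoc (c.inputsLaw ch) (noiseLaw n ch.varEve) (noiseLaw n u))
    have e1 := h1.measureReal_preimage hset.nullMeasurableSet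
    have e2 := (c.measurePreserving_inputs_dest ch).measureReal_preimage hset.nullMeasurableSet
    rw [errorProb]
    refine Eq.trans ?_ (e1.trans e2.symm)
    congr 1
    ext x
    simp only [hY, Set.mem_ofPred_eq, Set.mem_preimage, Function.comp_apply]
    have : (fun i l => c.mix a x.1.1 i l + γ l * x.1.2 i l) + x.2
        = c.mix a x.1.1 + fun i l => γ l * x.1.2 i l + x.2 i l := by
      ext i l; simp [add_assoc]
    rw [this]
    rfl
  have hint : ∫ x, ℓ x ∂(((c.inputsLaw ch).prod (noiseLaw n ch.varEve)).prod (noiseLaw n u))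
      ≤ n * (∑ l, D l + (l₁ * P₁ + l₂ * P₂) / 2) := by
    simp only [hℓ]
    rw [integral_finsetSum _ fun i _ => integrable_finsetSum _ fun l _ => (hlr i l).1]
    simp only [integral_finsetSum _ fun l _ => (hlr _ l).1]
    have hterm : ∀ i l, ∫ x : (Inputs L n M × Signal n L) × Signal n L,
        logRatio (s l) (u l) (c.mix a x.1.1 i l + γ l * x.1.2 i l)
          (α l * (c.mix b x.1.1 i l + x.1.2 i l)) (x.2 i l)
          ∂(((c.inputsLaw ch).prod (noiseLaw n ch.varEve)).prod (noiseLaw n u))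
        ≤ D l + (l₁ * ∫ b, b.1.2 i l ^ 2 ∂(c.inputsLaw ch)
          + l₂ * ∫ b, c.relayInputOf b i l ^ 2 ∂(c.inputsLaw ch)) / 2 := by
      intro i l
      rw [(hlr i l).2]
      have hsl : (0 : ℝ) < s l := hs l
      -- The domination by a diagonal form eliminates the cross moment of the two inputs, about
      -- which the code gives no information.
      have h1 : ∫ x : Inputs L n M, ((1 - α l) * x.1.2 i l
          + (a l - α l * b l) * c.relayInputOf x i l) ^ 2 ∂(c.inputsLaw ch)
          ≤ s l * (l₁ * ∫ b, b.1.2 i l ^ 2 ∂(c.inputsLaw ch)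
          + l₂ * ∫ b, c.relayInputOf b i l ^ 2 ∂(c.inputsLaw ch)) := by
        rw [← integral_const_mul, ← integral_const_mul, ← integral_add
          ((hX₁ l i).integrable_sq.const_mul _) ((hX₂ l i).integrable_sq.const_mul _),
          ← integral_const_mul]
        exact integral_mono (hA2 i l).integrable_sq
          ((((hX₁ l i).integrable_sq.const_mul _).add
            ((hX₂ l i).integrable_sq.const_mul _)).const_mul _) fun x => hquad l _ _
      have h2 := div_le_div_of_nonneg_right h1 (by positivity : (0 : ℝ) ≤ 2 * s l)
      have h3 : ∀ Q : ℝ, s l * Q / (2 * s l) = Q / 2 := fun Q => by field_simp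
      rw [h3] at h2
      have := hval l
      rw [add_assoc (∫ x : Inputs L n M, _ ∂(c.inputsLaw ch)), add_div]
      linarith
    have hconst : ∑ _i : Fin n, ∑ l, D l = n * ∑ l, D l := by simp
    calc _ ≤ ∑ i : Fin n, ∑ l, (D l + (l₁ * ∫ b, b.1.2 i l ^ 2 ∂(c.inputsLaw ch)
          + l₂ * ∫ b, c.relayInputOf b i l ^ 2 ∂(c.inputsLaw ch)) / 2) :=
          Finset.sum_le_sum fun i _ => Finset.sum_le_sum fun l _ => hterm i l
      _ = n * ∑ l, D l + (l₁ * ∑ l, ∑ i : Fin n, ∫ b, b.1.2 i l ^ 2 ∂(c.inputsLaw ch)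
          + l₂ * ∑ l, ∑ i : Fin n, ∫ b, c.relayInputOf b i l ^ 2 ∂(c.inputsLaw ch)) / 2 := by
          simp only [Finset.sum_add_distrib, ← Finset.sum_div, ← Finset.mul_sum, hconst]
          rw [Finset.sum_comm, Finset.sum_comm (f := fun i l =>
            ∫ b, c.relayInputOf b i l ^ 2 ∂(c.inputsLaw ch))]
      _ ≤ _ := by
          have h1 := mul_le_mul_of_nonneg_left hS₁ hl₁
          have h2 := mul_le_mul_of_nonneg_left hS₂ hl₂
          linarith
  rw [hent, ← herr]
  linarith

end Code

/-! ### Mutual information of Gaussian inputs -/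

/-- Mutual information over a channel with additive Gaussian noise whose noiseless output is
centered Gaussian. -/
theorem mutualInfo_add_gaussian {E : Type*} [MeasurableSpace E] {G : Measure E}
    [IsProbabilityMeasure G] {φ : E → ℝ} (hφ : Measurable φ) {S v : ℝ≥0} (hv : 0 < v)
    (hG : G.map φ = gaussianReal 0 S) :
    mutualInfo (fun s : E × ℝ => s.1) (fun s => φ s.1 + s.2) (G.prod (gaussianReal 0 v))
      = Real.log (1 + S / v) / 2 / Real.log 2 := by
  have hσ : 0 < S + v := add_pos_of_nonneg_of_pos bot_le hv
  have hv' : (0 : ℝ) < v := hv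
  have hσ' : (0 : ℝ) < (S + v : ℝ≥0) := hσ
  have hYm : Measurable fun s : E × ℝ => φ s.1 + s.2 :=
    (hφ.comp measurable_fst).add measurable_snd
  have hmap1 : (G.prod (gaussianReal 0 v)).map (fun s => s.1) = G :=
    (measurePreserving_fst (μ := G) (ν := gaussianReal 0 v)).map_eq
  have hmap2 : (G.prod (gaussianReal 0 v)).map (fun s => φ s.1 + s.2)
      = gaussianReal 0 (S + v) := by
    have e : (fun s : E × ℝ => φ s.1 + s.2)
        = (fun q : ℝ × ℝ => 1 * q.1 + q.2) ∘ Prod.map φ id := by ext; simp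
    rw [e, ← Measure.map_map (by fun_prop) (by fun_prop), ← Measure.map_prod_map _ _ hφ
      measurable_id, Measure.map_id, hG]
    exact map_prod_gaussianReal_add_mul 1 (by push_cast; ring)
  set ℓ : E × ℝ → ℝ := fun x => Real.log ((S + v : ℝ≥0) / v) / 2 - (x.2 - φ x.1) ^ 2 / (2 * v)
    + (x.2 - 0) ^ 2 / (2 * (S + v : ℝ≥0)) with hℓ
  have hℓm : Measurable ℓ := by fun_prop
  set J := (G.prod (gaussianReal 0 v)).map fun s => (s.1, φ s.1 + s.2) with hJ
  set Q := G.prod (gaussianReal 0 (S + v)) with hQ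
  have hJm : Measurable fun s : E × ℝ => (s.1, φ s.1 + s.2) := measurable_fst.prodMk hYm
  have hprob : IsProbabilityMeasure J := Measure.isProbabilityMeasure_map hJm.aemeasurable
  have hexp : Measurable fun x => ENNReal.ofReal (Real.exp (ℓ x)) := hℓm.exp.ennreal_ofReal
  have hJQ : J = Q.withDensity fun x => ENNReal.ofReal (Real.exp (ℓ x)) := by
    refine Measure.ext_of_lintegral _ fun F hF => ?_
    rw [lintegral_withDensity_eq_lintegral_mul _ hexp hF, hJ, lintegral_map hF hJm, hQ,
      lintegral_prod (fun s : E × ℝ => F (s.1, φ s.1 + s.2)) (hF.comp hJm).aemeasurable,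
      lintegral_prod _ (hexp.mul hF).aemeasurable]
    refine lintegral_congr fun x => ?_
    have hFx : Measurable fun y => F (x, y) := hF.comp measurable_prodMk_left
    have h1 : ∫⁻ z, F (x, φ x + z) ∂(gaussianReal 0 v) = ∫⁻ y, F (x, y) ∂(gaussianReal (φ x) v) := by
      have := gaussianReal_map_const_add (μ := 0) (v := v) (φ x)
      rw [zero_add] at this
      rw [← this, lintegral_map hFx (measurable_const_add _)]
    rw [h1, gaussianReal_eq_withDensity (φ x) 0 hv hσ,
      lintegral_withDensity_eq_lintegral_mul _ (by fun_prop) hFx]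
    rfl
  have hac : J ≪ Q := hJQ ▸ withDensity_absolutelyContinuous _ _
  have hllr : llr J Q =ᵐ[J] ℓ := by
    have := hac.ae_le (Measure.rnDeriv_withDensity Q hexp)
    rw [← hJQ] at this
    filter_upwards [this] with x hx
    rw [llr, hx, ENNReal.toReal_ofReal (Real.exp_pos _).le, Real.log_exp]
  have hφ2 : MemLp φ 2 G := by
    have : MemLp (id ∘ φ) 2 G := by
      rw [← memLp_map_measure_iff (by fun_prop) hφ.aemeasurable, hG]
      exact memLp_id_gaussianReal' 2 (by simp)
    exact this
  have hφsq : ∫ x, φ x ^ 2 ∂G = S := by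
    rw [← integral_sq_gaussianReal S, ← hG, integral_map hφ.aemeasurable (by fun_prop)]
  have hid : MemLp (fun z : ℝ => z) 2 (gaussianReal 0 v) := memLp_id_gaussianReal' 2 (by simp)
  obtain ⟨h1, e1⟩ := integral_add_sq_prod hφ2 hid integral_id_gaussianReal
  have hz : MemLp (fun s : E × ℝ => s.2) 2 (G.prod (gaussianReal 0 v)) := hid.comp_snd G
  -- The two quadratic terms both have mean `1 / 2` and cancel.
  have hint : ∫ x, ℓ x ∂J = Real.log ((S + v : ℝ≥0) / v) / 2 := by
    rw [hJ, integral_map hJm.aemeasurable hℓm.aestronglyMeasurable]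
    have e : ∀ s : E × ℝ, ℓ (s.1, φ s.1 + s.2) = (Real.log ((S + v : ℝ≥0) / v) / 2
        - s.2 ^ 2 / (2 * v)) + (φ s.1 + s.2) ^ 2 / (2 * (S + v : ℝ≥0)) := fun s => by
      simp only [hℓ]; ring
    have hi : Integrable (fun s : E × ℝ => Real.log ((S + v : ℝ≥0) / v) / 2
        - s.2 ^ 2 / (2 * (v : ℝ))) (G.prod (gaussianReal 0 v)) :=
      (integrable_const _).sub (hz.integrable_sq.div_const _)
    simp only [e]
    rw [integral_add hi (h1.integrable_sq.div_const _), integral_sub (integrable_const _)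
      (hz.integrable_sq.div_const _), integral_div, integral_div, integral_div, e1, hφsq,
      integral_fun_snd (fun z : ℝ => z ^ 2), integral_sq_gaussianReal]
    have : (S : ℝ) + v = (S + v : ℝ≥0) := by push_cast; ring
    rw [this]
    simp only [integral_const, probReal_univ, smul_eq_mul, one_mul]
    field_simp
    ring
  rw [mutualInfo, hmap1, hmap2, InformationTheory.toReal_klDiv_of_measure_eq hac (by simp),
    integral_congr_ae hllr, hint]
  congr 3
  push_cast
  field_simp
  ring

lemma posSemidef_inputCov {p₁ p₂ ψ : ℝ} (h₁ : 0 ≤ p₁) (h₂ : 0 ≤ p₂) (hψ : -1 ≤ ψ ∧ ψ ≤ 1) :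
    (inputCov p₁ p₂ ψ).PosSemidef := by
  refine Matrix.PosSemidef.of_dotProduct_mulVec_nonneg ?_ fun x => ?_
  · ext i j
    fin_cases i <;> fin_cases j <;> simp [inputCov]
  · simp only [inputCov, dotProduct, Matrix.mulVec, Fin.sum_univ_two, star_trivial,
      Matrix.of_apply, Matrix.cons_val', Matrix.cons_val_zero, Matrix.cons_val_one,
      Matrix.cons_val_fin_one]
    have e : x 0 * (p₁ * x 0 + ψ * √(p₁ * p₂) * x 1) + x 1 * (ψ * √(p₁ * p₂) * x 0 + p₂ * x 1)
        = (√p₁ * x 0 + ψ * (√p₂ * x 1)) ^ 2 + (1 - ψ ^ 2) * (√p₂ * x 1) ^ 2 := by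
      rw [Real.sqrt_mul h₁]
      nth_rewrite 1 [← Real.sq_sqrt h₁]
      nth_rewrite 3 [← Real.sq_sqrt h₂]
      ring
    rw [e]
    have : 0 ≤ 1 - ψ ^ 2 := by nlinarith
    positivity

lemma cross_sq_le {p₁ p₂ ψ : ℝ} (h₁ : 0 ≤ p₁) (h₂ : 0 ≤ p₂) (hψ : -1 ≤ ψ ∧ ψ ≤ 1) :
    (ψ * √(p₁ * p₂)) ^ 2 ≤ p₁ * p₂ := by
  rw [mul_pow, Real.sq_sqrt (mul_nonneg h₁ h₂)]
  have : ψ ^ 2 ≤ 1 := by nlinarith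
  exact mul_le_of_le_one_left (mul_nonneg h₁ h₂) this

/-- The noiseless output is a continuous linear functional of a Gaussian vector, hence a real
Gaussian whose variance is the received power. -/
theorem gaussianInfo_inputCov {ρ v : ℝ≥0} (hv : 0 < v) {p₁ p₂ ψ : ℝ} (h₁ : 0 ≤ p₁) (h₂ : 0 ≤ p₂)
    (hψ : -1 ≤ ψ ∧ ψ ≤ 1) :
    gaussianInfo ρ v (inputCov p₁ p₂ ψ)
      = Real.log (1 + rxPower √(ρ : ℝ) p₁ p₂ (ψ * √(p₁ * p₂)) / v) / 2 / Real.log 2 := by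
  have hK := posSemidef_inputCov h₁ h₂ hψ
  have hS := rxPower_nonneg (a := √(ρ : ℝ)) h₁ h₂ (cross_sq_le h₁ h₂ hψ)
  set f : StrongDual ℝ (EuclideanSpace ℝ (Fin 2)) :=
    EuclideanSpace.proj 0 + √(ρ : ℝ) • EuclideanSpace.proj 1 with hf
  have hfa : ∀ x, f x = x 0 + √(ρ : ℝ) * x 1 := fun x => by simp [hf]
  have hmap : (multivariateGaussian 0 (inputCov p₁ p₂ ψ)).map f
      = gaussianReal 0 (rxPower √(ρ : ℝ) p₁ p₂ (ψ * √(p₁ * p₂))).toNNReal := by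
    rw [IsGaussian.map_eq_gaussianReal, ContinuousLinearMap.integral_comp_id_comm
      IsGaussian.integrable_id, integral_id_multivariateGaussian, map_zero]
    congr 2
    have hm : ∀ i : Fin 2, MemLp (fun x : EuclideanSpace ℝ (Fin 2) => x i) 2
        (multivariateGaussian 0 (inputCov p₁ p₂ ψ)) := fun i =>
      IsGaussian.memLp_dual _ (EuclideanSpace.proj i) 2 (by simp)
    have e : (⇑f) = fun x : EuclideanSpace ℝ (Fin 2) => x 0 + √(ρ : ℝ) * x 1 := funext hfa
    rw [e, variance_fun_add (hm 0) ((hm 1).const_mul _), variance_const_mul,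
      covariance_const_mul_right, variance_eval_multivariateGaussian hK,
      variance_eval_multivariateGaussian hK, covariance_eval_multivariateGaussian hK]
    simp only [inputCov, rxPower, Matrix.of_apply, Matrix.cons_val', Matrix.cons_val_zero,
      Matrix.cons_val_one, Matrix.cons_val_fin_one]
    ring
  have h := mutualInfo_add_gaussian f.measurable hv hmap
  rw [Real.coe_toNNReal _ hS] at h
  rw [← h, gaussianInfo, singleUseLaw]
  simp only [hfa]

/-! ### The Gaussian optimization problem -/

section Optimization

variable {L : ℕ} (ch : GaussianChannel L)

/-- Second moments `(E X₁ₗ², E X₂ₗ², E X₁ₗX₂ₗ)` of the inputs of the subchannels. -/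
abbrev Moments (L : ℕ) : Type := (Fin L → ℝ) × (Fin L → ℝ) × (Fin L → ℝ)

/-- Moments that satisfy the power constraints. -/
def feasibleSet (L : ℕ) (P₁ P₂ : ℝ) : Set (Moments L) :=
  {K | IsFeasible P₁ P₂ K.1 K.2.1 K.2.2}

/-- Sum over the subchannels of the information differences, in nats. -/
def totalInfo (K : Moments L) : ℝ :=
  ∑ l, secrecyInfo √(ch.ρ₁ l : ℝ) √(ch.ρ₂ l : ℝ) (ch.varDest l) (ch.varEve l)
    (K.1 l) (K.2.1 l) (K.2.2 l)

lemma zero_mem_feasibleSet {P₁ P₂ : ℝ} (hP₁ : 0 ≤ P₁) (hP₂ : 0 ≤ P₂) :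
    (0 : Moments L) ∈ feasibleSet L P₁ P₂ :=
  ⟨by simp, by simp, by simp, by simpa using hP₁, by simpa using hP₂⟩

lemma feasibleSet_mono {P₁ P₂ Q₁ Q₂ : ℝ} (h₁ : P₁ ≤ Q₁) (h₂ : P₂ ≤ Q₂) :
    feasibleSet L P₁ P₂ ⊆ feasibleSet L Q₁ Q₂ := fun _ h =>
  ⟨h.left_nonneg, h.right_nonneg, h.cross_sq_le, h.sum_left_le.trans h₁, h.sum_right_le.trans h₂⟩

lemma isClosed_feasibleSet (P₁ P₂ : ℝ) : IsClosed (feasibleSet L P₁ P₂) := by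
  have e : feasibleSet L P₁ P₂ = (⋂ l, {K | 0 ≤ K.1 l}) ∩ (⋂ l, {K | 0 ≤ K.2.1 l})
      ∩ (⋂ l, {K | K.2.2 l ^ 2 ≤ K.1 l * K.2.1 l}) ∩ {K | ∑ l, K.1 l ≤ P₁}
      ∩ {K | ∑ l, K.2.1 l ≤ P₂} := by
    ext K
    simp only [feasibleSet, Set.mem_ofPred_eq, Set.mem_inter_iff, Set.mem_iInter]
    exact ⟨fun h => ⟨⟨⟨⟨h.left_nonneg, h.right_nonneg⟩, h.cross_sq_le⟩, h.sum_left_le⟩,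
      h.sum_right_le⟩, fun h => ⟨h.1.1.1.1, h.1.1.1.2, h.1.1.2, h.1.2, h.2⟩⟩
  rw [e]
  refine ((((isClosed_iInter fun l => ?_).inter (isClosed_iInter fun l => ?_)).inter
    (isClosed_iInter fun l => ?_)).inter ?_).inter ?_
  all_goals exact isClosed_le (by fun_prop) (by fun_prop)

lemma isCompact_feasibleSet (P₁ P₂ : ℝ) : IsCompact (feasibleSet L P₁ P₂) := by
  refine (isCompact_Icc (a := ((0, 0, fun _ => -(P₁ + P₂)) : Moments L))
    (b := (fun _ => P₁, fun _ => P₂, fun _ => P₁ + P₂))).of_isClosed_subset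
    (isClosed_feasibleSet P₁ P₂) fun K hK => ?_
  have h1 : ∀ l, K.1 l ≤ P₁ := fun l =>
    (Finset.single_le_sum (fun l _ => hK.left_nonneg l) (Finset.mem_univ l)).trans hK.sum_left_le
  have h2 : ∀ l, K.2.1 l ≤ P₂ := fun l =>
    (Finset.single_le_sum (fun l _ => hK.right_nonneg l) (Finset.mem_univ l)).trans hK.sum_right_le
  have h3 : ∀ l, |K.2.2 l| ≤ P₁ + P₂ := fun l => by
    have p := hK.left_nonneg l
    have r := hK.right_nonneg l
    refine le_trans (abs_le_of_sq_le_sq ?_ (add_nonneg p r)) (add_le_add (h1 l) (h2 l))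
    nlinarith [hK.cross_sq_le l]
  exact ⟨⟨hK.left_nonneg, hK.right_nonneg, fun l => (abs_le.1 (h3 l)).1⟩,
    ⟨h1, h2, fun l => (abs_le.1 (h3 l)).2⟩⟩

lemma continuousOn_totalInfo (P₁ P₂ : ℝ) :
    ContinuousOn (totalInfo ch) (feasibleSet L P₁ P₂) := by
  refine continuousOn_finsetSum _ fun l _ => ?_
  have key : ∀ (a : ℝ) (v : ℝ≥0), 0 < v → ContinuousOn (fun K : Moments L =>
      Real.log (1 + rxPower a (K.1 l) (K.2.1 l) (K.2.2 l) / v)) (feasibleSet L P₁ P₂) := by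
    intro a v hv
    refine ContinuousOn.log (Continuous.continuousOn (by unfold rxPower; fun_prop)) fun K hK => ?_
    have := rxPower_nonneg (a := a) (hK.left_nonneg l) (hK.right_nonneg l) (hK.cross_sq_le l)
    positivity
  exact ((key _ _ (ch.varDest_pos l)).sub (key _ _ (ch.varEve_pos l))).div_const 2

/-- The correlation `ψ` and the cross moment `c` correspond through `c = ψ √(p r)`; the moment form
has a closed feasible set and a continuous objective. -/
lemma mem_gaussianSecrecyValues {P₁ P₂ v : ℝ} :
    v ∈ gaussianSecrecyValues ch P₁ P₂
      ↔ ∃ K ∈ feasibleSet L P₁ P₂, v = totalInfo ch K / Real.log 2 := by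
  have hval : ∀ {p₁ p₂ ψ : Fin L → ℝ}, (∀ l, 0 ≤ p₁ l) → (∀ l, 0 ≤ p₂ l) →
      (∀ l, -1 ≤ ψ l ∧ ψ l ≤ 1) →
      ∑ l, (gaussianInfo (ch.ρ₁ l) (ch.varDest l) (inputCov (p₁ l) (p₂ l) (ψ l))
        - gaussianInfo (ch.ρ₂ l) (ch.varEve l) (inputCov (p₁ l) (p₂ l) (ψ l)))
      = totalInfo ch (p₁, p₂, fun l => ψ l * √(p₁ l * p₂ l)) / Real.log 2 := by
    intro p₁ p₂ ψ h₁ h₂ hψ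
    rw [totalInfo, Finset.sum_div]
    refine Finset.sum_congr rfl fun l _ => ?_
    rw [gaussianInfo_inputCov (ch.varDest_pos l) (h₁ l) (h₂ l) (hψ l),
      gaussianInfo_inputCov (ch.varEve_pos l) (h₁ l) (h₂ l) (hψ l), secrecyInfo]
    ring
  constructor
  · rintro ⟨p₁, p₂, ψ, h₁, h₂, hψ, s₁, s₂, rfl⟩
    exact ⟨(p₁, p₂, fun l => ψ l * √(p₁ l * p₂ l)),
      ⟨h₁, h₂, fun l => cross_sq_le (h₁ l) (h₂ l) (hψ l), s₁, s₂⟩, hval h₁ h₂ hψ⟩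
  · rintro ⟨⟨p, r, c⟩, hK, rfl⟩
    have hc : ∀ l, |c l| ≤ √(p l * r l) := fun l => Real.abs_le_sqrt (hK.cross_sq_le l)
    have hψ : ∀ l, -1 ≤ c l / √(p l * r l) ∧ c l / √(p l * r l) ≤ 1 := fun l => by
      rw [← abs_le, abs_div, abs_of_nonneg (Real.sqrt_nonneg _)]
      exact div_le_one_of_le₀ (hc l) (Real.sqrt_nonneg _)
    refine ⟨p, r, fun l => c l / √(p l * r l), hK.left_nonneg, hK.right_nonneg, hψ,
      hK.sum_left_le, hK.sum_right_le, ?_⟩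
    rw [hval hK.left_nonneg hK.right_nonneg hψ]
    congr 3
    refine Prod.ext rfl (funext fun l => ?_)
    -- When a power vanishes, so does `c`, and the correlation `c / 0 = 0` still reproduces it.
    by_cases h0 : √(p l * r l) = 0
    · have : c l = 0 := abs_nonpos_iff.1 (h0 ▸ hc l)
      simp [this]
    · exact (div_mul_cancel₀ _ h0).symm

end Optimization

/-! ### From codes to the Gaussian bound -/

section Converse

variable {L : ℕ} {ch : GaussianChannel L}

/-- The absolute value covers negative rates; the extra `1` absorbs the ceiling, since `2 ^ (n |R|)
≥ 1`. -/
lemma log_numMessages_le (n : ℕ) (R : ℝ) :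
    Real.log (numMessages n R) ≤ (n * |R| + 1) * Real.log 2 := by
  have h1 : (2 : ℝ) ^ ((n : ℝ) * R) ≤ 2 ^ ((n : ℝ) * |R|) :=
    Real.rpow_le_rpow_of_exponent_le one_le_two
      (mul_le_mul_of_nonneg_left (le_abs_self R) (Nat.cast_nonneg n))
  have h2 : (1 : ℝ) ≤ 2 ^ ((n : ℝ) * |R|) :=
    Real.one_le_rpow one_le_two (by positivity)
  have h3 : (numMessages n R : ℝ) ≤ 2 ^ ((n : ℝ) * |R| + 1) := by
    rw [Real.rpow_add two_pos, Real.rpow_one]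
    have := Nat.ceil_lt_add_one (Real.rpow_nonneg zero_le_two ((n : ℝ) * R))
    rw [numMessages]
    linarith
  rw [← Real.log_rpow two_pos]
  exact Real.log_le_log (Nat.cast_pos.2 (NeZero.pos _)) h3

/-- A linear bound on the equivocation of codes bounds the achievable equivocation rates. -/
lemma equivocation_le_of_condEntropy_le {P₁ P₂ R Re C : ℝ} (hach : IsAchievable ch P₁ P₂ R Re)
    (hC : ∀ n : ℕ, ∀ c : Code L n (numMessages n R), c.SatisfiesPower ch P₁ P₂ →
      condEntropy Code.message (c.eveOutput ch) (c.law ch) * Real.log 2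
        ≤ n * C + Real.log 2 + c.errorProb ch * Real.log (numMessages n R)) :
    Re * Real.log 2 ≤ C := by
  have hlog : 0 < Real.log 2 := Real.log_pos one_lt_two
  have key : ∀ η : ℝ, 0 < η → Re * Real.log 2 ≤ C + η * Real.log 2 * (2 + |R| + η) := by
    intro η hη
    obtain ⟨N, hN⟩ := hach η hη
    -- Taking `n > 1 / η` lets the constant terms `(1 + η) log 2` be absorbed into a multiple of `η
    -- n`.
    obtain ⟨n, hnN, hn⟩ : ∃ n : ℕ, N ≤ n ∧ 1 / η < n := by
      obtain ⟨m, hm⟩ := exists_nat_gt (1 / η)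
      exact ⟨max N m, le_max_left _ _, hm.trans_le (by exact_mod_cast le_max_right N m)⟩
    have hn0 : (0 : ℝ) < n := lt_trans (by positivity) hn
    obtain ⟨c, hpow, -, hRe, herr⟩ := hN n hnN
    have h1 := hC n c hpow
    rw [le_div_iff₀ hn0] at hRe
    have h2 : c.errorProb ch * Real.log (numMessages n R) ≤ η * ((n * |R| + 1) * Real.log 2) :=
      mul_le_mul herr (log_numMessages_le n R) (Real.log_nonneg (by
        exact_mod_cast Nat.one_le_iff_ne_zero.2 (NeZero.ne _))) hη.le
    have h3 := mul_le_mul_of_nonneg_right hRe hlog.le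
    have h4 : 1 ≤ η * n := by
      rw [div_lt_iff₀ hη] at hn
      linarith
    have h5 : n * (Re * Real.log 2) ≤ n * (C + η * Real.log 2 * (2 + |R| + η)) := by
      have h6 : Real.log 2 * (1 + η) ≤ Real.log 2 * (1 + η) * (η * n) :=
        le_mul_of_one_le_right (by positivity) h4
      linarith
    exact le_of_mul_le_mul_left h5 hn0
  have hlim : Filter.Tendsto (fun η : ℝ => C + η * Real.log 2 * (2 + |R| + η))
      (nhdsWithin 0 (Set.Ioi 0)) (nhds C) := by
    have : Continuous fun η : ℝ => C + η * Real.log 2 * (2 + |R| + η) := by fun_prop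
    have h := this.tendsto 0
    simp only [zero_mul, add_zero] at h
    exact h.mono_left nhdsWithin_le_nhds
  exact ge_of_tendsto hlim (Filter.eventually_of_mem self_mem_nhdsWithin key)

/-- Up to a small relaxation of the power constraints, an achievable equivocation rate is bounded
by the information difference of Gaussian inputs. -/
theorem exists_feasible_of_isAchievable {P₁ P₂ R Re ε : ℝ} (hP₁ : 0 ≤ P₁) (hP₂ : 0 ≤ P₂)
    (hε : 0 < ε) (hach : IsAchievable ch P₁ P₂ R Re) :
    ∃ K ∈ feasibleSet L (P₁ + ε) (P₂ + ε),
      Re * Real.log 2 ≤ totalInfo ch K + ε * (P₁ + P₂ + 2 * ε) := by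
  -- The penalty `ε` makes both multipliers positive, and the enlarged budgets are positive even if
  -- `P₁` or `P₂` is zero.
  obtain ⟨K, hK, hmax⟩ := (isCompact_feasibleSet (L := L) (P₁ + ε) (P₂ + ε)).exists_isMaxOn
    ⟨0, zero_mem_feasibleSet (by positivity) (by positivity)⟩
    (f := fun K => totalInfo ch K - ∑ l, ε * (K.1 l + K.2.1 l))
    ((continuousOn_totalInfo ch _ _).sub (Continuous.continuousOn (by fun_prop)))
  obtain ⟨l₁, l₂, hl₁, hl₂, hform, htr, hslack⟩ := exists_multipliers
    (a := fun l => √(ch.ρ₁ l : ℝ)) (b := fun l => √(ch.ρ₂ l : ℝ))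
    (v := fun l => (ch.varDest l : ℝ)) (w := fun l => (ch.varEve l : ℝ))
    (fun l => ch.varDest_pos l) (fun l => ch.varEve_pos l) (by positivity : 0 < P₁ + ε)
    (by positivity : 0 < P₂ + ε) hε hK (fun p' r' c' h' => by
      have := isMaxOn_iff.1 hmax (p', r', c') h'
      simpa only [totalInfo, Finset.sum_sub_distrib] using this)
  refine ⟨K, hK, ?_⟩
  choose α γ s u hu hs hvar hquad hval using fun l =>
    exists_tight_correlation (v := (ch.varDest l : ℝ)) (w := (ch.varEve l : ℝ))
      (NNReal.coe_pos.2 (ch.varDest_pos l)) (NNReal.coe_pos.2 (ch.varEve_pos l)) hl₁ hl₂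
      (hK.left_nonneg l)
      (hK.right_nonneg l) (hK.cross_sq_le l) (hform l) (htr l)
  refine equivocation_le_of_condEntropy_le hach fun n c hpow => ?_
  have h := c.condEntropy_le ch hP₁ hP₂ hl₁.le hl₂.le hpow (s := fun l => ⟨s l, (hs l).le⟩)
    (u := fun l => ⟨u l, (hu l).le⟩) (fun l => hs l) (fun l => hu l) hvar hquad
    (fun l => (hval l).le)
  refine h.trans (add_le_add_left (add_le_add_left
    (mul_le_mul_of_nonneg_left ?_ (Nat.cast_nonneg n)) _) _)
  rw [Finset.sum_sub_distrib, ← Finset.sum_div, totalInfo]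
  have h1 : l₁ * P₁ ≤ l₁ * (P₁ + ε) := by gcongr; linarith
  have h2 : l₂ * P₂ ≤ l₂ * (P₂ + ε) := by gcongr; linarith
  linarith

/-- An achievable equivocation rate is at most the information difference of some Gaussian inputs
that satisfy the power constraints. -/
theorem exists_le_totalInfo_of_isAchievable {P₁ P₂ R Re : ℝ} (hP₁ : 0 ≤ P₁) (hP₂ : 0 ≤ P₂)
    (hach : IsAchievable ch P₁ P₂ R Re) :
    ∃ K ∈ feasibleSet L P₁ P₂, Re * Real.log 2 ≤ totalInfo ch K := by
  have hpos : ∀ k : ℕ, (0 : ℝ) < 1 / ((k : ℝ) + 1) := fun k => Nat.one_div_pos_of_nat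
  choose K hK hle using fun k : ℕ => exists_feasible_of_isAchievable hP₁ hP₂ (hpos k) hach
  have hle1 : ∀ k : ℕ, 1 / ((k : ℝ) + 1) ≤ 1 := fun k => by
    rw [div_le_one (by positivity)]
    have : (0 : ℝ) ≤ k := Nat.cast_nonneg k
    linarith
  have hK1 : ∀ k, K k ∈ feasibleSet L (P₁ + 1) (P₂ + 1) := fun k =>
    feasibleSet_mono (by linarith [hle1 k]) (by linarith [hle1 k]) (hK k)
  -- The feasible sets vary with `k`, so the subsequence is extracted in the fixed compact set with
  -- budgets enlarged by `1`; the limit meets the original budgets.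
  obtain ⟨K₀, hK₀, φ, hφ, hlim⟩ := (isCompact_feasibleSet (P₁ + 1) (P₂ + 1)).tendsto_subseq hK1
  have hε : Filter.Tendsto (fun k : ℕ => 1 / (((φ k : ℕ) : ℝ) + 1)) Filter.atTop (nhds 0) :=
    tendsto_one_div_add_atTop_nhds_zero_nat.comp hφ.tendsto_atTop
  refine ⟨K₀, ⟨hK₀.left_nonneg, hK₀.right_nonneg, hK₀.cross_sq_le, ?_, ?_⟩, ?_⟩
  · have h1 : Filter.Tendsto (fun k => ∑ l, (K (φ k)).1 l) Filter.atTop (nhds (∑ l, K₀.1 l)) :=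
      ((by fun_prop : Continuous fun K : Moments L => ∑ l, K.1 l).tendsto K₀).comp hlim
    have h2 := hε.const_add P₁
    rw [add_zero] at h2
    exact le_of_tendsto_of_tendsto' h1 h2 fun k => (hK (φ k)).sum_left_le
  · have h1 : Filter.Tendsto (fun k => ∑ l, (K (φ k)).2.1 l) Filter.atTop
        (nhds (∑ l, K₀.2.1 l)) :=
      ((by fun_prop : Continuous fun K : Moments L => ∑ l, K.2.1 l).tendsto K₀).comp hlim
    have h2 := hε.const_add P₂
    rw [add_zero] at h2
    exact le_of_tendsto_of_tendsto' h1 h2 fun k => (hK (φ k)).sum_right_le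
  · have h1 : Filter.Tendsto (fun k => totalInfo ch (K (φ k))) Filter.atTop
        (nhds (totalInfo ch K₀)) :=
      (continuousOn_totalInfo ch (P₁ + 1) (P₂ + 1) K₀ hK₀).tendsto.comp
        (tendsto_nhdsWithin_iff.2 ⟨hlim, Filter.Eventually.of_forall fun k => hK1 _⟩)
    have h2 := h1.add (hε.mul ((hε.const_mul 2).const_add (P₁ + P₂)))
    rw [zero_mul, add_zero] at h2
    exact ge_of_tendsto' h2 fun k => hle (φ k)

end Converse

end RelayEavesdropper

end

/-! ### Attainment of the maximum and the converse -/

open RelayEavesdropper in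
theorem theorem3 {L : ℕ} (ch : GaussianChannel L) (P₁ P₂ : ℝ) (hP₁ : 0 ≤ P₁) (hP₂ : 0 ≤ P₂) :
    ∃ B : ℝ, IsGreatest (gaussianSecrecyValues ch P₁ P₂) B ∧
      (∀ R Re : ℝ, IsAchievable ch P₁ P₂ R Re → Re ≤ B) ∧
      (∀ R : ℝ, IsAchievableSecrecyRate ch P₁ P₂ R → R ≤ B) := by
  have hlog : 0 < Real.log 2 := Real.log_pos one_lt_two
  obtain ⟨K, hK, hmax⟩ := (isCompact_feasibleSet (L := L) P₁ P₂).exists_isMaxOn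
    ⟨0, zero_mem_feasibleSet hP₁ hP₂⟩ (continuousOn_totalInfo ch P₁ P₂)
  have hachievable : ∀ R Re : ℝ, IsAchievable ch P₁ P₂ R Re →
      Re ≤ totalInfo ch K / Real.log 2 := fun R Re h => by
    obtain ⟨K', hK', hle⟩ := exists_le_totalInfo_of_isAchievable hP₁ hP₂ h
    rw [le_div_iff₀ hlog]
    exact hle.trans (hmax hK')
  refine ⟨totalInfo ch K / Real.log 2, ⟨(mem_gaussianSecrecyValues ch).2 ⟨K, hK, rfl⟩, ?_⟩,
    hachievable, fun R h => hachievable R R h⟩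
  intro v hv
  obtain ⟨K', hK', rfl⟩ := (mem_gaussianSecrecyValues ch).1 hv
  exact div_le_div_of_nonneg_right (hmax hK') hlog.le
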